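/- **Conventions.** A (linear) permutation of length $n\ge 0$ is a word $\pi=\pi_1\cdots\pi_n$ of $n$ distinct positive integers; the cyclic permutation $[\pi]$ is the set of its rotations. A linear (resp. cyclic) permutation statistic is a function on linear (resp. cyclic) permutations that depends only on the relative order of the letters. $\mathrm{Des}\,\pi=\{i\in[n-1]:\pi_i>\pi_{i+1}\}$ and $\mathrm{cDes}\,\pi=\{i\in[n]:\pi_i>\pi_{i+1}\}$ with $\pi_{n+1}=\pi_1$. The composition $\mathrm{Comp}\,S$ of $n$ attached to $S=\{s_1<\dots<s_j\}\subseteq[n-1]$ is $(s_1,s_2-s_1,\dots,n-s_j)$, and is empty for $n=0$; $\mathrm{Comp}\,\pi=\mathrm{Comp}(\mathrm{Des}\,\pi)$. A subset $S\subseteq[n]$ is non-Escher if $S=\mathrm{cDes}\,\pi$ for some $\pi$ of length $n$; then $\mathrm{cComp}[S]$ is the cyclic composition (composition up to cyclic shift) $[(s_2-s_1,\dots,s_j-s_{j-1},n-s_j+s_1)]$ if $n\ge2$, $[(1)]$ if $n=1$, and $\varnothing$ if $n=0$; these are the non-Escher cyclic compositions, and $\mathrm{cComp}[\pi]=\mathrm{cComp}[\mathrm{cDes}\,\pi]$.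 A descent statistic $\mathrm{st}$ is a linear statistic depending only on $\mathrm{Comp}\,\pi$, and a cyclic descent statistic $\mathrm{cst}$ is a cyclic statistic depending only on $\mathrm{cComp}[\pi]$; so $\mathrm{st}\,L$ and $\mathrm{cst}[L]$ make sense for compositions $L$ and non-Escher cyclic compositions $[L]$. Compositions $L,K$ of the same size are $\mathrm{st}$-equivalent if $\mathrm{st}\,L=\mathrm{st}\,K$; likewise non-Escher cyclic compositions of the same size, and cyclic permutations of the same length, are $\mathrm{cst}$-equivalent if they have the same value of $\mathrm{cst}$. A shuffle of permutations $\pi,\sigma$ without common letters is a permutation of length $|\pi|+|\sigma|$ containing both as subsequences; $\mathrm{Sh}([\pi],[\sigma])$ is the set of all $[\tau]$ with $\tau$ a shuffle of some $\bar\pi\in[\pi]$ and $\bar\sigma\in[\sigma]$. The statistic $\mathrm{st}$ (resp. $\mathrm{cst}$) is shuffle-compatible (resp. cyclic shuffle-compatible) if the multiset of its values over the (cyclic) shuffles of two disjoint (cyclic) permutations depends only on their lengths and their values of the statistic. The space $\mathcal A^{\mathrm{cyc}}_{\mathrm{cst}}$ is the $\mathbb Q$-vector space with basis the $\mathrm{cst}$-equivalence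 classes $[\pi]_{\mathrm{cst}}$ of cyclic permutations; if $\mathrm{cst}$ is cyclic shuffle-compatible it is an algebra under $[\pi]_{\mathrm{cst}}[\sigma]_{\mathrm{cst}}=\sum_{[\tau]\in\mathrm{Sh}([\pi],[\sigma])}[\tau]_{\mathrm{cst}}$ for disjoint $\pi,\sigma$, with unit $[\varnothing]_{\mathrm{cst}}$. $\mathrm{QSym}$ is the $\mathbb Q$-algebra of quasisymmetric functions in $x_1,x_2,\dots$ and, for $S\subseteq[n-1]$, $F_{n,S}=F_{\mathrm{Comp}\,S}=\sum x_{i_1}\cdots x_{i_n}$ over $i_1\le\dots\le i_n$ with $i_j<i_{j+1}$ for $j\in S$. For $S\subseteq[n]$ let $S+i$ be the cyclic shift modulo $n$, and let $F^{\mathrm{cyc}}_{n,S}=\sum_{i\in[n]}F_{n,(S+i)\cap[n-1]}$ for $n\ge1$ and $F^{\mathrm{cyc}}_{0,\varnothing}=1$. Let $\mathrm{cQSym}^-$ be the span of all $F^{\mathrm{cyc}}_{n,S}$ with $n\ge0$ and $S\subseteq[n]$ non-Escher. **Theorem 3.7.** Let $\mathrm{cst}$ be a cyclic descent statistic and let $\mathrm{st}$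 be a shuffle-compatible descent statistic. Let $A$ be a $\mathbb Q$-algebra with a basis $\{u_\alpha\}$ indexed by the $\mathrm{st}$-equivalence classes $\alpha$ of compositions, and let $\phi_{\mathrm{st}}\colon\mathrm{QSym}\to A$ be a $\mathbb Q$-algebra homomorphism with $\phi_{\mathrm{st}}(F_L)=u_\alpha$ whenever $L\in\alpha$. Then $\mathrm{cQSym}^-$ is a subalgebra of $\mathrm{QSym}$, and there is a unique $\mathbb Q$-algebra homomorphism $\phi_{\mathrm{cst}}\colon\mathrm{cQSym}^-\to A$ with $$\phi_{\mathrm{cst}}(F^{\mathrm{cyc}}_{n,S})=\sum_{i\in[n]}\phi_{\mathrm{st}}\bigl(F_{n,(S+i)\cap[n-1]}\bigr)\quad(n\ge1),\qquad \phi_{\mathrm{cst}}(F^{\mathrm{cyc}}_{0,\varnothing})=1,$$ for all non-Escher $S\subseteq[n]$. Suppose moreover that $\phi_{\mathrm{cst}}(F^{\mathrm{cyc}}_{n,S})$ depends only on the $\mathrm{cst}$-equivalence class $\alpha$ of $\mathrm{cComp}[S]$, write $v_\alpha$ for this value, and suppose that the family $\{v_\alpha\}$, indexed by the $\mathrm{cst}$-equivalence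 classes of non-Escher cyclic compositions, is linearly independent. Then $\mathrm{cst}$ is cyclic shuffle-compatible, the span of $\{v_\alpha\}$ is a subalgebra of $A$, and the linear map given by $[\pi]_{\mathrm{cst}}\mapsto v_\alpha$, where $\mathrm{cComp}[\pi]\in\alpha$, is a $\mathbb Q$-algebra isomorphism from $\mathcal A^{\mathrm{cyc}}_{\mathrm{cst}}$ onto this span. -/

import Mathlib

namespace CyclicShuffle

/-! ## Linear and cyclic permutations -/

/-- A linear permutation: a finite word of distinct positive integers. -/
@[ext]
structure LinPerm where
  word : List ℕ+
  nodup : word.Nodup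

/-- The length of a linear permutation. -/
def LinPerm.length (π : LinPerm) : ℕ := π.word.length

/-- The empty permutation. -/
def LinPerm.empty : LinPerm := ⟨[], List.nodup_nil⟩

/-- A cyclic permutation: a word of distinct positive integers up to rotation. -/
def CycPerm : Type := {c : Cycle ℕ+ // c.Nodup}

/-- The length of a cyclic permutation. -/
def CycPerm.length (c : CycPerm) : ℕ := c.1.length

/-- The cyclic permutation `[π]`. -/
def LinPerm.cyc (π : LinPerm) : CycPerm := ⟨(π.word : Cycle ℕ+), π.nodup⟩

/-- The standardization: the letter `a` becomes `k` if it is the `k`-th smallest letter. -/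
def LinPerm.std (π : LinPerm) : List ℕ :=
  π.word.map fun a => (π.word.filter fun b => b ≤ a).length

/-- Two permutations have the same relative order if their standardizations agree. -/
def SameOrder (π σ : LinPerm) : Prop := π.std = σ.std

/-- A (linear) permutation statistic. -/
structure LinStat (β : Type*) where
  toFun : LinPerm → β
  map_sameOrder : ∀ π σ, SameOrder π σ → toFun π = toFun σ

/-- A cyclic permutation statistic. -/
structure CycStat (β : Type*) where
  toFun : CycPerm → β
  map_sameOrder : ∀ π σ : LinPerm, SameOrder π σ → toFun π.cyc = toFun σ.cyc

/-! ## Shuffles -/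

/-- `π` and `σ` have no letter in common. -/
def LinPerm.Disj (π σ : LinPerm) : Prop := List.Disjoint π.word σ.word

/-- `τ` is a shuffle of the disjoint permutations `π` and `σ`. -/
def IsShuffle (π σ τ : LinPerm) : Prop :=
  π.Disj σ ∧ τ.length = π.length + σ.length ∧
    π.word.Sublist τ.word ∧ σ.word.Sublist τ.word

/-- `c` and `d` have no letter in common. -/
def CycPerm.Disj (c d : CycPerm) : Prop := ∀ a, a ∈ c.1 → a ∉ d.1

/-- `t` is a cyclic shuffle of the disjoint cyclic permutations `c` and `d`: some representative
of `t` is a shuffle of representatives of `c` and `d`. -/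
def IsCycShuffle (c d t : CycPerm) : Prop :=
  ∃ π σ τ : LinPerm, π.cyc = c ∧ σ.cyc = d ∧ τ.cyc = t ∧ IsShuffle π σ τ

theorem IsShuffle.perm {π σ τ : LinPerm} (h : IsShuffle π σ τ) :
    (π.word ++ σ.word).Perm τ.word := by
  obtain ⟨hd, hl, h1, h2⟩ := h
  have hn : (π.word ++ σ.word).Nodup := List.Nodup.append π.nodup σ.nodup hd
  have hs : (π.word ++ σ.word) ⊆ τ.word :=
    List.append_subset.2 ⟨h1.subset, h2.subset⟩
  refine (List.subperm_of_subset hn hs).perm_of_length_le ?_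
  rw [List.length_append]
  exact hl.le

theorem finite_perm (l : List ℕ+) : {τ : LinPerm | l.Perm τ.word}.Finite := by
  refine Set.Finite.of_finite_image (f := LinPerm.word) ?_ ?_
  · refine (List.finite_toSet l.permutations).subset ?_
    rintro _ ⟨τ, hτ, rfl⟩
    exact List.mem_permutations.2 (List.Perm.symm hτ)
  · intro a _ b _ h
    exact LinPerm.ext h

theorem finite_shuffles (π σ : LinPerm) : {τ | IsShuffle π σ τ}.Finite :=
  (finite_perm (π.word ++ σ.word)).subset fun _ h => h.perm

theorem CycPerm.exists_rep (c : CycPerm) : ∃ π : LinPerm, π.cyc = c := by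
  obtain ⟨c, hc⟩ := c
  induction c using Quotient.inductionOn with
  | _ l => exact ⟨⟨l, hc⟩, rfl⟩

theorem LinPerm.perm_of_cyc_eq {π σ : LinPerm} (h : π.cyc = σ.cyc) : π.word.Perm σ.word := by
  have h' : (π.word : Cycle ℕ+) = σ.word := congrArg Subtype.val h
  exact (Cycle.coe_eq_coe.1 h').perm

theorem finite_cycShuffles (c d : CycPerm) : {t | IsCycShuffle c d t}.Finite := by
  obtain ⟨π₀, rfl⟩ := c.exists_rep
  obtain ⟨σ₀, rfl⟩ := d.exists_rep
  refine ((finite_perm (π₀.word ++ σ₀.word)).image LinPerm.cyc).subset ?_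
  rintro t ⟨π, σ, τ, hπ, hσ, rfl, h⟩
  exact ⟨τ, ((LinPerm.perm_of_cyc_eq hπ).symm.append (LinPerm.perm_of_cyc_eq hσ).symm).trans
    h.perm, rfl⟩

/-- The finite set of shuffles of `π` and `σ`. -/
noncomputable def shuffles (π σ : LinPerm) : Finset LinPerm := (finite_shuffles π σ).toFinset

/-- The finite set of cyclic shuffles of `c` and `d`. -/
noncomputable def cycShuffles (c d : CycPerm) : Finset CycPerm := (finite_cycShuffles c d).toFinset

/-- Shuffle-compatibility: the distribution (a multiset) of the statistic over the shuffles of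
two disjoint permutations depends only on their lengths and on the values of the statistic. -/
def LinStat.ShuffleCompatible {β : Type*} (st : LinStat β) : Prop :=
  ∀ π σ π' σ' : LinPerm, π.Disj σ → π'.Disj σ' →
    st.toFun π = st.toFun π' → st.toFun σ = st.toFun σ' →
    π.length = π'.length → σ.length = σ'.length →
    (shuffles π σ).val.map st.toFun = (shuffles π' σ').val.map st.toFun

/-- Cyclic shuffle-compatibility. -/
def CycStat.CyclicShuffleCompatible {β : Type*} (cst : CycStat β) : Prop :=
  ∀ c d c' d' : CycPerm, c.Disj d → c'.Disj d' →
    cst.toFun c = cst.toFun c' → cst.toFun d = cst.toFun d' →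
    c.length = c'.length → d.length = d'.length →
    (cycShuffles c d).val.map cst.toFun = (cycShuffles c' d').val.map cst.toFun

/-! ## Descent sets and descent compositions -/

/-- The descent set `{i ∈ [n-1] : π_i > π_{i+1}}` (the word is stored with indices from `0`). -/
def LinPerm.des (π : LinPerm) : Finset ℕ :=
  (Finset.Icc 1 (π.length - 1)).filter fun i => π.word.getD i 1 < π.word.getD (i - 1) 1

/-- The cyclic descent set `{i ∈ [n] : π_i > π_{i+1}}`, where `π_{n+1} = π_1`. -/
def LinPerm.cDes (π : LinPerm) : Finset ℕ :=
  (Finset.Icc 1 π.length).filter fun i =>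
    π.word.getD (i % π.length) 1 < π.word.getD (i - 1) 1

/-- The composition `(s₁, s₂ - s₁, …, n - s_j)` of `n` attached to
`S = {s₁ < ⋯ < s_j} ⊆ [n-1]`, by way of its set of partial sums. -/
def compOfSet (n : ℕ) (S : Finset ℕ) : Composition n :=
  CompositionAsSet.toComposition
    { boundaries := Finset.univ.filter fun j : Fin (n + 1) =>
        j = 0 ∨ j = Fin.last n ∨ (j : ℕ) ∈ S
      zero_mem := by simp
      getLast_mem := by simp }

/-- The set `{L₁, L₁ + L₂, …, L₁ + ⋯ + L_{k-1}}` of a composition `L` with `k` parts. -/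
def desOfComp {n : ℕ} (L : Composition n) : Finset ℕ :=
  (Finset.Ico 1 L.length).image L.sizeUpTo

/-- Compositions of arbitrary size; the first component is the size. -/
abbrev AnyComp : Type := Σ n : ℕ, Composition n

/-- The descent composition of a permutation. -/
def LinPerm.comp (π : LinPerm) : AnyComp := ⟨π.length, compOfSet π.length π.des⟩

/-- A descent statistic depends only on the descent composition. -/
def LinStat.IsDescentStat {β : Type*} (st : LinStat β) : Prop :=
  ∀ π σ : LinPerm, π.comp = σ.comp → st.toFun π = st.toFun σ

theorem compOfSet_desOfComp {n : ℕ} (L : Composition n) : compOfSet n (desOfComp L) = L := by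
  refine Eq.trans ?_ ((compositionEquiv n).symm_apply_apply L)
  refine congrArg CompositionAsSet.toComposition (CompositionAsSet.ext ?_)
  change (Finset.univ.filter fun j : Fin (n + 1) =>
    j = 0 ∨ j = Fin.last n ∨ (j : ℕ) ∈ desOfComp L) = L.boundaries
  refine Finset.ext fun j => Finset.mem_filter.trans ?_
  simp only [Finset.mem_univ, true_and, desOfComp, Finset.mem_image,
    Finset.mem_Ico, Composition.boundaries, Finset.mem_map, RelEmbedding.coe_toEmbedding]
  constructor
  · rintro (rfl | rfl | ⟨i, hi, hij⟩)
    · exact ⟨0, L.boundary_zero⟩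
    · exact ⟨Fin.last _, L.boundary_last⟩
    · exact ⟨⟨i, by omega⟩, Fin.ext hij⟩
  · rintro ⟨i, rfl⟩
    by_cases h0 : (i : ℕ) = 0
    · left
      have : i = 0 := Fin.ext h0
      subst this
      exact L.boundary_zero
    · by_cases hl : (i : ℕ) = L.length
      · right; left
        have : i = Fin.last _ := Fin.ext hl
        subst this
        exact L.boundary_last
      · right; right
        exact ⟨i, ⟨by omega, by omega⟩, rfl⟩

theorem desOfComp_subset {n : ℕ} (L : Composition n) : desOfComp L ⊆ Finset.Icc 1 (n - 1) := by
  intro s hs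
  simp only [desOfComp, Finset.mem_image, Finset.mem_Ico] at hs
  obtain ⟨i, ⟨h1, h2⟩, rfl⟩ := hs
  have ha : L.sizeUpTo 0 < L.sizeUpTo i := by
    have h3 := L.sizeUpTo_strict_mono (i := 0) (by omega)
    have h4 : L.sizeUpTo (0 + 1) ≤ L.sizeUpTo i := L.monotone_sizeUpTo (by omega)
    omega
  have hb : L.sizeUpTo i < n := by
    have h3 := L.sizeUpTo_strict_mono (i := i) h2
    have h4 := L.sizeUpTo_le (i + 1)
    omega
  simp only [Finset.mem_Icc]
  omega

theorem exists_des (n : ℕ) (S : Finset ℕ) (hS : S ⊆ Finset.Icc 1 (n - 1)) :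
    ∃ π : LinPerm, π.length = n ∧ π.des = S := by
  let g : ℕ → ℕ := fun i => n * (S.filter fun s => i < s).card + i
  let f : ℕ → ℕ+ := fun i => Nat.succPNat (g i)
  have hnd : ((List.range n).map f).Nodup := by
    refine List.Nodup.map_on ?_ List.nodup_range
    intro x hx y hy hxy
    have h1 : g x = g y := Nat.succPNat_injective hxy
    have h2 := congrArg (fun z => z % n) h1
    simp only [g, Nat.mul_add_mod] at h2
    rwa [Nat.mod_eq_of_lt (List.mem_range.1 hx), Nat.mod_eq_of_lt (List.mem_range.1 hy)] at h2
  refine ⟨⟨(List.range n).map f, hnd⟩, by simp [LinPerm.length], ?_⟩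
  have hget : ∀ i, i < n → ((List.range n).map f).getD i 1 = f i := by
    intro i hi
    simp [List.getD, hi]
  ext i
  simp only [LinPerm.des, LinPerm.length, List.length_map, List.length_range, Finset.mem_filter,
    Finset.mem_Icc]
  have key : 1 ≤ i ∧ i ≤ n - 1 → (f i < f (i - 1) ↔ i ∈ S) := by
    rintro ⟨h1, h2⟩
    rw [show f i < f (i - 1) ↔ g i < g (i - 1) from Nat.succPNat_lt_succPNat]
    by_cases hi : i ∈ S
    · have : (S.filter fun s => i - 1 < s) = insert i (S.filter fun s => i < s) := by
        ext s
        simp only [Finset.mem_filter, Finset.mem_insert]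
        constructor
        · rintro ⟨ha, hb⟩
          by_cases hsi : s = i
          · exact Or.inl hsi
          · exact Or.inr ⟨ha, by omega⟩
        · rintro (rfl | ⟨ha, hb⟩)
          · exact ⟨hi, by omega⟩
          · exact ⟨ha, by omega⟩
      simp only [g, this, hi, iff_true]
      rw [Finset.card_insert_of_notMem (by simp), mul_add]
      omega
    · have : (S.filter fun s => i - 1 < s) = S.filter fun s => i < s := by
        ext s
        simp only [Finset.mem_filter]
        constructor
        · rintro ⟨ha, hb⟩
          have : s ≠ i := fun h => hi (h ▸ ha)
          exact ⟨ha, by omega⟩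
        · rintro ⟨ha, hb⟩
          exact ⟨ha, by omega⟩
      simp only [g, this, hi, iff_false]
      omega
  constructor
  · rintro ⟨h, h'⟩
    rw [hget i (by omega), hget (i - 1) (by omega)] at h'
    exact (key h).1 h'
  · intro h
    have h2 := Finset.mem_Icc.1 (hS h)
    refine ⟨h2, ?_⟩
    rw [hget i (by omega), hget (i - 1) (by omega)]
    exact (key h2).2 h

/-- Every composition is the descent composition of some permutation. -/
theorem exists_comp (L : AnyComp) : ∃ π : LinPerm, π.comp = L := by
  obtain ⟨n, L⟩ := L
  obtain ⟨π, rfl, h⟩ := exists_des n (desOfComp L) (desOfComp_subset L)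
  exact ⟨π, by rw [LinPerm.comp, h, compOfSet_desOfComp]⟩

/-- The value `st L` of a descent statistic on any permutation with descent composition `L`. -/
noncomputable def LinStat.onComp {β : Type*} (st : LinStat β) (L : AnyComp) : β :=
  st.toFun (exists_comp L).choose

/-- `st`-equivalence of compositions: same size and same value of `st`. -/
noncomputable def LinStat.compSetoid {β : Type*} (st : LinStat β) : Setoid AnyComp :=
  Setoid.ker fun L => (L.1, st.onComp L)

/-- The `st`-equivalence classes of compositions. -/
def LinStat.CompClass {β : Type*} (st : LinStat β) : Type := Quotient st.compSetoid

/-- The `st`-equivalence class of a composition. -/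
noncomputable def LinStat.compClass {β : Type*} (st : LinStat β) (L : AnyComp) : st.CompClass :=
  Quotient.mk st.compSetoid L

/-! ## Cyclic descent compositions -/

/-- The cyclic shift `S + i` of `S ⊆ [n]`, with values modulo `n` in `[n] = {1, …, n}`. -/
def cycShift (n : ℕ) (S : Finset ℕ) (i : ℕ) : Finset ℕ :=
  S.image fun s => (s + i - 1) % n + 1

/-- `S` is a non-Escher subset of `[n]`: the cyclic descent set of a permutation of length `n`. -/
def NonEscher (n : ℕ) (S : Finset ℕ) : Prop :=
  ∃ π : LinPerm, π.length = n ∧ π.cDes = S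

/-- The composition `(s₂ - s₁, …, s_j - s_{j-1}, n - s_j + s₁)` of a non-Escher subset
`S = {s₁ < ⋯ < s_j}` of `[n]` if `n ≥ 2`; it is `(1)` if `n = 1` and empty if `n = 0`. -/
noncomputable def cCompList (n : ℕ) (S : Finset ℕ) : List ℕ :=
  if n = 0 then [] else if n = 1 then [1] else
    let s := S.sort (· ≤ ·)
    List.zipWith (fun a b => b - a) s (s.tail ++ [n + s.headD 0])

/-- The cyclic composition `cComp [S]`. -/
noncomputable def cComp (n : ℕ) (S : Finset ℕ) : Cycle ℕ := (cCompList n S : Cycle ℕ)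

/-- The cyclic descent composition of `[π]`, computed from the representative `π`. -/
noncomputable def LinPerm.cComp (π : LinPerm) : Cycle ℕ := CyclicShuffle.cComp π.length π.cDes

/-- A cyclic descent statistic depends only on the cyclic descent composition. -/
def CycStat.IsCyclicDescentStat {β : Type*} (cst : CycStat β) : Prop :=
  ∀ π σ : LinPerm, π.cComp = σ.cComp → cst.toFun π.cyc = cst.toFun σ.cyc

/-- Non-Escher cyclic compositions. -/
def NECycComp : Type := {c : Cycle ℕ // ∃ n S, NonEscher n S ∧ c = cComp n S}

/-- The size of a cyclic composition: the sum of its parts. -/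
def NECycComp.size (c : NECycComp) : ℕ := c.1.toMultiset.sum

/-- The cyclic composition `cComp [S]` of a non-Escher set. -/
noncomputable def neCComp (n : ℕ) (S : Finset ℕ) (h : NonEscher n S) : NECycComp :=
  ⟨cComp n S, n, S, h, rfl⟩

theorem LinPerm.nonEscher (π : LinPerm) : NonEscher π.length π.cDes := ⟨π, rfl, rfl⟩

theorem NECycComp.exists_perm (c : NECycComp) : ∃ π : LinPerm, π.cComp = c.1 := by
  obtain ⟨c, n, S, ⟨π, rfl, rfl⟩, rfl⟩ := c
  exact ⟨π, rfl⟩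

/-- The value `cst [L]` of a cyclic descent statistic on any cyclic permutation with cyclic
descent composition `[L]`. -/
noncomputable def CycStat.onComp {β : Type*} (cst : CycStat β) (c : NECycComp) : β :=
  cst.toFun c.exists_perm.choose.cyc

/-- `cst`-equivalence of non-Escher cyclic compositions: same size and same value of `cst`. -/
noncomputable def CycStat.compSetoid {β : Type*} (cst : CycStat β) : Setoid NECycComp :=
  Setoid.ker fun c => (c.size, cst.onComp c)

/-- The `cst`-equivalence classes of non-Escher cyclic compositions. -/
def CycStat.CompClass {β : Type*} (cst : CycStat β) : Type := Quotient cst.compSetoid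

/-- The `cst`-equivalence class of a non-Escher cyclic composition. -/
noncomputable def CycStat.compClass {β : Type*} (cst : CycStat β) (c : NECycComp) : cst.CompClass :=
  Quotient.mk cst.compSetoid c

/-! ## The cyclic shuffle algebra -/

/-- `cst`-equivalence of cyclic permutations: same length and same value of `cst`. -/
def CycStat.permSetoid {β : Type*} (cst : CycStat β) : Setoid CycPerm :=
  Setoid.ker fun c => (c.length, cst.toFun c)

/-- The `cst`-equivalence classes of cyclic permutations. -/
def CycStat.PermClass {β : Type*} (cst : CycStat β) : Type := Quotient cst.permSetoid

/-- The `cst`-equivalence class of a cyclic permutation. -/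
def CycStat.permClass {β : Type*} (cst : CycStat β) (c : CycPerm) : cst.PermClass :=
  Quotient.mk cst.permSetoid c

/-- Any two classes have disjoint representatives. -/
theorem CycStat.exists_disj {β : Type*} (cst : CycStat β) (x y : cst.PermClass) :
    ∃ p : CycPerm × CycPerm, cst.permClass p.1 = x ∧ cst.permClass p.2 = y ∧ p.1.Disj p.2 := by
  obtain ⟨c, rfl⟩ := Quotient.exists_rep x
  obtain ⟨d, rfl⟩ := Quotient.exists_rep y
  obtain ⟨π, rfl⟩ := c.exists_rep
  obtain ⟨σ, rfl⟩ := d.exists_rep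
  obtain ⟨N, hN⟩ := π.word.toFinset.exists_le
  let σ' : LinPerm := ⟨σ.word.map (· + N), σ.nodup.map (add_left_injective N)⟩
  have hstd : SameOrder σ' σ := by
    simp only [SameOrder, LinPerm.std, σ', List.map_map, List.filter_map, List.length_map]
    refine List.map_congr_left fun a _ => ?_
    simp [Function.comp_def]
  refine ⟨(π.cyc, σ'.cyc), rfl, ?_, ?_⟩
  · refine Quotient.sound (s := cst.permSetoid) ?_
    have h1 : σ'.cyc.length = σ.cyc.length := by
      change (σ.word.map (· + N)).length = σ.word.length
      simp
    exact Prod.ext h1 (cst.map_sameOrder _ _ hstd)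
  · intro a ha hb
    have ha' : a ∈ π.word := ha
    have hb' : a ∈ σ.word.map (· + N) := hb
    obtain ⟨b, _, rfl⟩ := List.mem_map.1 hb'
    have := hN _ (List.mem_toFinset.2 ha')
    have h2 : N < b + N := PNat.lt_add_left N b
    exact absurd this (not_le.2 h2)

theorem IsCycShuffle.length {c d t : CycPerm} (h : IsCycShuffle c d t) :
    t.length = c.length + d.length := by
  obtain ⟨π, σ, τ, rfl, rfl, rfl, h⟩ := h
  exact h.2.1

/-- The rational vector space with basis the `cst`-equivalence classes of cyclic permutations,
which carries the product of the cyclic shuffle algebra. -/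
def CycStat.Alg {β : Type*} (cst : CycStat β) : Type := cst.PermClass →₀ ℚ

noncomputable instance {β : Type*} (cst : CycStat β) : AddCommGroup cst.Alg :=
  inferInstanceAs (AddCommGroup (cst.PermClass →₀ ℚ))

noncomputable instance {β : Type*} (cst : CycStat β) : Module ℚ cst.Alg :=
  inferInstanceAs (Module ℚ (cst.PermClass →₀ ℚ))

/-- The basis element of a class. -/
noncomputable def CycStat.basisElt {β : Type*} (cst : CycStat β) (x : cst.PermClass) : cst.Alg :=
  (Finsupp.single x 1 : cst.PermClass →₀ ℚ)

/-- The basis element `[π]_cst` of a cyclic permutation `[π]`. -/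
noncomputable def CycStat.of {β : Type*} (cst : CycStat β) (c : CycPerm) : cst.Alg :=
  cst.basisElt (cst.permClass c)

/-- The product of two basis elements: the sum of `[τ]_cst` over the cyclic shuffles `[τ]` of
disjoint representatives. The choice does not matter if `cst` is cyclic shuffle-compatible,
see `CycStat.of_mul_of`. -/
noncomputable def CycStat.mulBasis {β : Type*} (cst : CycStat β) (x y : cst.PermClass) :
    cst.Alg :=
  ∑ t ∈ cycShuffles (cst.exists_disj x y).choose.1 (cst.exists_disj x y).choose.2, cst.of t

/-- The bilinear extension of the product of basis elements. -/
noncomputable instance {β : Type*} (cst : CycStat β) : Mul cst.Alg where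
  mul f g := Finsupp.sum (show cst.PermClass →₀ ℚ from f) fun x a =>
    Finsupp.sum (show cst.PermClass →₀ ℚ from g) fun y b => (a * b) • cst.mulBasis x y

/-- The unit is the class of the empty permutation. -/
noncomputable instance {β : Type*} (cst : CycStat β) : One cst.Alg where
  one := cst.of LinPerm.empty.cyc

/-- For a cyclic shuffle-compatible statistic, the product can be computed with any disjoint
representatives. -/
theorem CycStat.of_mul_of {β : Type*} (cst : CycStat β) (h : cst.CyclicShuffleCompatible)
    (c d : CycPerm) (hcd : c.Disj d) :
    cst.of c * cst.of d = ∑ t ∈ cycShuffles c d, cst.of t := by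
  classical
  have h0 : cst.of c * cst.of d = cst.mulBasis (cst.permClass c) (cst.permClass d) := by
    change Finsupp.sum (Finsupp.single (cst.permClass c) (1 : ℚ)) (fun x a =>
      Finsupp.sum (Finsupp.single (cst.permClass d) (1 : ℚ)) fun y b =>
        (a * b) • cst.mulBasis x y) = _
    rw [Finsupp.sum_single_index (by simp [Finsupp.sum]), Finsupp.sum_single_index (by simp)]
    simp
  rw [h0, CycStat.mulBasis]
  obtain ⟨hc, hd, hdisj⟩ := (cst.exists_disj (cst.permClass c) (cst.permClass d)).choose_spec
  generalize (cst.exists_disj (cst.permClass c) (cst.permClass d)).choose = p at hc hd hdisj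
  obtain ⟨c', d'⟩ := p
  have hc' : (c'.length, cst.toFun c') = (c.length, cst.toFun c) :=
    Quotient.exact (s := cst.permSetoid) hc
  have hd' : (d'.length, cst.toFun d') = (d.length, cst.toFun d) :=
    Quotient.exact (s := cst.permSetoid) hd
  rw [Prod.mk.injEq] at hc' hd'
  have hm := h c' d' c d hdisj hcd hc'.2 hd'.2 hc'.1 hd'.1
  let G : β → cst.Alg := fun b =>
    if hb : ∃ t : CycPerm, t.length = c.length + d.length ∧ cst.toFun t = b then cst.of hb.choose
    else 0
  have hG : ∀ t : CycPerm, t.length = c.length + d.length → cst.of t = G (cst.toFun t) := by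
    intro t ht
    have hb : ∃ s : CycPerm, s.length = c.length + d.length ∧ cst.toFun s = cst.toFun t :=
      ⟨t, ht, rfl⟩
    simp only [G, dif_pos hb]
    have hs := hb.choose_spec
    refine congrArg cst.basisElt (Quotient.sound (s := cst.permSetoid) ?_)
    exact Prod.ext (ht.trans hs.1.symm) hs.2.symm
  have hsum : ∀ T : Finset CycPerm, (∀ t ∈ T, t.length = c.length + d.length) →
      ∑ t ∈ T, cst.of t = ((T.val.map cst.toFun).map G).sum := by
    intro T hT
    rw [Multiset.map_map]
    exact Finset.sum_congr rfl fun t ht => hG t (hT t ht)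
  rw [hsum, hsum, hm]
  · intro t ht
    exact ((finite_cycShuffles c d).mem_toFinset.1 ht).length
  · intro t ht
    have := ((finite_cycShuffles c' d').mem_toFinset.1 ht).length
    rw [this, hc'.1, hd'.1]

/-! ## Quasisymmetric functions -/

/-- The monomial `x_{i₁}^{a₁} ⋯ x_{i_k}^{a_k}` as an exponent vector. -/
noncomputable def mono {k : ℕ} (i : Fin k → ℕ) (a : Fin k → ℕ) : ℕ →₀ ℕ :=
  ∑ t, Finsupp.single (i t) (a t)

/-- A power series of bounded degree is quasisymmetric if the coefficients of
`x_{i₁}^{a₁} ⋯ x_{i_k}^{a_k}` and `x_{j₁}^{a₁} ⋯ x_{j_k}^{a_k}` agree for all positive `a`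
and all strictly increasing `i`, `j`. The variables are indexed by `ℕ`. -/
def IsQuasisymmetric (f : MvPowerSeries ℕ ℚ) : Prop :=
  (∃ d : ℕ, ∀ m : ℕ →₀ ℕ, d < m.degree → MvPowerSeries.coeff m f = 0) ∧
    ∀ (k : ℕ) (a i j : Fin k → ℕ), (∀ t, 0 < a t) → StrictMono i → StrictMono j →
      MvPowerSeries.coeff (mono i a) f = MvPowerSeries.coeff (mono j a) f

theorem mono_apply {k : ℕ} (i a : Fin k → ℕ) (x : ℕ) :
    mono i a x = ∑ t, if i t = x then a t else 0 := by
  simp [mono, Finsupp.single_apply]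

theorem mono_apply_self {k : ℕ} {i : Fin k → ℕ} (hi : Function.Injective i) (a : Fin k → ℕ)
    (t : Fin k) : mono i a (i t) = a t := by
  simp [mono_apply, hi.eq_iff]

theorem mono_apply_of_notMem {k : ℕ} {i : Fin k → ℕ} (a : Fin k → ℕ) {x : ℕ}
    (hx : x ∉ Set.range i) : mono i a x = 0 := by
  rw [mono_apply]
  exact Finset.sum_eq_zero fun t _ => if_neg fun h => hx ⟨t, h⟩

theorem mono_add {k : ℕ} (i a b : Fin k → ℕ) : mono i (a + b) = mono i a + mono i b := by
  simp [mono, Finset.sum_add_distrib]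

theorem eq_mono_of_le {k : ℕ} {i : Fin k → ℕ} (hi : Function.Injective i) {a : Fin k → ℕ}
    {m : ℕ →₀ ℕ} (h : m ≤ mono i a) : m = mono i fun t => m (i t) := by
  ext x
  by_cases hx : x ∈ Set.range i
  · obtain ⟨t, rfl⟩ := hx
    rw [mono_apply_self hi]
  · rw [mono_apply_of_notMem _ hx]
    have := h x
    rw [mono_apply_of_notMem _ hx] at this
    omega

/-- The exponents may as well be allowed to vanish. -/
theorem IsQuasisymmetric.coeff_eq {f : MvPowerSeries ℕ ℚ} (hf : IsQuasisymmetric f)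
    {k : ℕ} (a i j : Fin k → ℕ) (hi : StrictMono i) (hj : StrictMono j) :
    MvPowerSeries.coeff (mono i a) f = MvPowerSeries.coeff (mono j a) f := by
  let s : Finset (Fin k) := Finset.univ.filter fun t => 0 < a t
  let e := s.orderEmbOfFin rfl
  have key : ∀ i : Fin k → ℕ, mono i a = mono (i ∘ e) (a ∘ e) := by
    intro i
    have h1 : mono i a = ∑ t ∈ s, Finsupp.single (i t) (a t) := by
      refine (Finset.sum_subset (Finset.subset_univ s) ?_).symm
      intro t _ ht
      have : a t = 0 := by simpa [s] using ht
      simp [this]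
    have h2 : Finset.univ.map e.toEmbedding = s := Finset.map_orderEmbOfFin_univ s rfl
    have h3 := Finset.sum_map Finset.univ e.toEmbedding fun t => Finsupp.single (i t) (a t)
    rw [h2] at h3
    exact h1.trans h3
  rw [key i, key j]
  refine hf.2 _ _ _ _ ?_ (hi.comp e.strictMono) (hj.comp e.strictMono)
  intro t
  have : e t ∈ s := Finset.orderEmbOfFin_mem s rfl t
  simpa [s] using this

theorem coeff_mono_mul {k : ℕ} {i : Fin k → ℕ} (hi : Function.Injective i) (a : Fin k → ℕ)
    (f g : MvPowerSeries ℕ ℚ) :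
    MvPowerSeries.coeff (mono i a) (f * g) =
      ∑ p ∈ Finset.HasAntidiagonal.antidiagonal (Finsupp.equivFunOnFinite.symm a),
        MvPowerSeries.coeff (mono i p.1) f * MvPowerSeries.coeff (mono i p.2) g := by
  classical
  rw [MvPowerSeries.coeff_mul]
  symm
  refine Finset.sum_bij (fun p _ => (mono i p.1, mono i p.2)) ?_ ?_ ?_ ?_
  · intro p hp
    rw [Finset.HasAntidiagonal.mem_antidiagonal] at hp ⊢
    rw [← mono_add, ← Finsupp.coe_add, hp]
    rfl
  · intro p _ q _ h
    rw [Prod.mk.injEq] at h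
    refine Prod.ext (Finsupp.ext fun t => ?_) (Finsupp.ext fun t => ?_)
    · rw [← mono_apply_self hi p.1 t, h.1, mono_apply_self hi]
    · rw [← mono_apply_self hi p.2 t, h.2, mono_apply_self hi]
  · rintro ⟨x, y⟩ hxy
    rw [Finset.HasAntidiagonal.mem_antidiagonal] at hxy
    have hx : x ≤ mono i a := hxy ▸ le_self_add
    have hy : y ≤ mono i a := hxy ▸ le_add_self
    refine ⟨(Finsupp.equivFunOnFinite.symm fun t => x (i t),
      Finsupp.equivFunOnFinite.symm fun t => y (i t)), ?_, ?_⟩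
    · rw [Finset.HasAntidiagonal.mem_antidiagonal]
      ext t
      have := DFunLike.congr_fun hxy (i t)
      rw [mono_apply_self hi] at this
      simpa using this
    · exact Prod.ext (eq_mono_of_le hi hx).symm (eq_mono_of_le hi hy).symm
  · intro p _
    rfl

theorem IsQuasisymmetric.mul {f g : MvPowerSeries ℕ ℚ} (hf : IsQuasisymmetric f)
    (hg : IsQuasisymmetric g) : IsQuasisymmetric (f * g) := by
  classical
  refine ⟨?_, ?_⟩
  · obtain ⟨c, hc⟩ := hf.1
    obtain ⟨d, hd⟩ := hg.1
    refine ⟨c + d, fun m hm => ?_⟩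
    rw [MvPowerSeries.coeff_mul]
    refine Finset.sum_eq_zero fun p hp => ?_
    rw [Finset.HasAntidiagonal.mem_antidiagonal] at hp
    rw [← hp, map_add] at hm
    by_cases h : c < p.1.degree
    · rw [hc _ h, zero_mul]
    · rw [hd _ (by omega), mul_zero]
  · intro k a i j _ hi hj
    rw [coeff_mono_mul hi.injective, coeff_mono_mul hj.injective]
    refine Finset.sum_congr rfl fun p _ => ?_
    rw [hf.coeff_eq p.1 i j hi hj, hg.coeff_eq p.2 i j hi hj]

theorem isQuasisymmetric_C (r : ℚ) : IsQuasisymmetric (MvPowerSeries.C r) := by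
  classical
  refine ⟨⟨0, fun m hm => ?_⟩, fun k a i j ha _ _ => ?_⟩
  · rw [MvPowerSeries.coeff_C, if_neg]
    rintro rfl
    simp at hm
  · have key : ∀ i : Fin k → ℕ, mono i a = 0 ↔ k = 0 := by
      intro i
      constructor
      · intro h
        by_contra hk
        have t : Fin k := ⟨0, by omega⟩
        have h1 : mono i a (i t) = 0 := by rw [h]; rfl
        rw [mono_apply, Finset.sum_eq_zero_iff] at h1
        have := h1 t (Finset.mem_univ t)
        have h2 := ha t
        simp at this
        omega
      · rintro rfl
        simp [mono]
    simp only [MvPowerSeries.coeff_C, key]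

/-- The algebra of quasisymmetric functions over `ℚ`. -/
noncomputable def QSym : Subalgebra ℚ (MvPowerSeries ℕ ℚ) where
  carrier := {f | IsQuasisymmetric f}
  mul_mem' := fun hf hg => hf.mul hg
  add_mem' := by
    rintro f g ⟨⟨c, hc⟩, hf⟩ ⟨⟨d, hd⟩, hg⟩
    refine ⟨⟨max c d, fun m hm => ?_⟩, fun k a i j ha hi hj => ?_⟩
    · rw [map_add, hc m (by omega), hd m (by omega), add_zero]
    · rw [map_add, map_add, hf k a i j ha hi hj, hg k a i j ha hi hj]
  algebraMap_mem' := fun r => isQuasisymmetric_C r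

/-- The index sequences `i₁ ≤ ⋯ ≤ i_n` with `i_j < i_{j+1}` for `j ∈ S` (the entry `i_{j+1}` is
stored as `w j`) whose monomial `x_{i₁} ⋯ x_{i_n}` is `m`. -/
def fundSeqs (n : ℕ) (S : Finset ℕ) (m : ℕ →₀ ℕ) : Set (Fin n → ℕ) :=
  {w | Monotone w ∧ (∀ p q : Fin n, (p : ℕ) + 1 = q → (q : ℕ) ∈ S → w p < w q) ∧
    mono w (fun _ => 1) = m}

/-- The fundamental quasisymmetric function `F_{n,S}` as a power series: the coefficient of a
monomial is the number of index sequences producing it. -/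
noncomputable def fundSeries (n : ℕ) (S : Finset ℕ) : MvPowerSeries ℕ ℚ :=
  fun m => ((fundSeqs n S m).ncard : ℚ)

theorem mono_one_apply {n : ℕ} (w : Fin n → ℕ) (x : ℕ) :
    mono w (fun _ => 1) x = (Finset.univ.filter fun p => w p = x).card := by
  rw [mono_apply, Finset.card_filter]

theorem ncard_fundSeqs (n : ℕ) (S : Finset ℕ) {k : ℕ} {a i : Fin k → ℕ} (hi : StrictMono i) :
    (fundSeqs n S (mono i a)).ncard = {w : Fin n → Fin k | Monotone w ∧
      (∀ p q : Fin n, (p : ℕ) + 1 = q → (q : ℕ) ∈ S → w p < w q) ∧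
      ∀ t, (Finset.univ.filter fun p => w p = t).card = a t}.ncard := by
  have hinj : Function.Injective fun w : Fin n → Fin k => i ∘ w := hi.injective.comp_left
  rw [← Set.ncard_image_of_injective _ hinj]
  congr 1
  ext w
  constructor
  · rintro ⟨h1, h2, h3⟩
    have hr : ∀ p, ∃ t, i t = w p := by
      intro p
      by_contra hp
      have h4 := mono_apply_of_notMem (i := i) a (x := w p) hp
      rw [← h3, mono_one_apply, Finset.card_eq_zero] at h4
      have : p ∈ Finset.univ.filter fun q => w q = w p := by simp
      rw [h4] at this
      simp at this
    choose v hv using hr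
    have hw : w = i ∘ v := funext fun p => (hv p).symm
    subst hw
    refine ⟨v, ⟨fun p q hpq => hi.le_iff_le.1 (h1 hpq),
      fun p q hpq hq => hi.lt_iff_lt.1 (h2 p q hpq hq), fun t => ?_⟩, rfl⟩
    rw [← mono_apply_self hi.injective a t, ← h3, mono_one_apply]
    simp [hi.injective.eq_iff]
  · rintro ⟨v, ⟨h1, h2, h3⟩, rfl⟩
    refine ⟨hi.monotone.comp h1, fun p q hpq hq => hi (h2 p q hpq hq), ?_⟩
    ext x
    rw [mono_one_apply]
    by_cases hx : x ∈ Set.range i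
    · obtain ⟨t, rfl⟩ := hx
      rw [mono_apply_self hi.injective, ← h3 t]
      simp [hi.injective.eq_iff]
    · rw [mono_apply_of_notMem _ hx, Finset.card_eq_zero, Finset.filter_eq_empty_iff]
      exact fun p _ hp => hx ⟨v p, hp⟩

theorem fundSeries_mem (n : ℕ) (S : Finset ℕ) : fundSeries n S ∈ QSym := by
  refine ⟨⟨n, fun m hm => ?_⟩, fun k a i j _ hi hj => ?_⟩
  · have : fundSeqs n S m = ∅ := by
      refine Set.eq_empty_of_forall_notMem ?_
      rintro w ⟨_, _, rfl⟩
      simp [mono, map_sum] at hm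
    change ((fundSeqs n S m).ncard : ℚ) = 0
    simp [this]
  · change ((fundSeqs n S (mono i a)).ncard : ℚ) = ((fundSeqs n S (mono j a)).ncard : ℚ)
    rw [ncard_fundSeqs n S hi, ncard_fundSeqs n S hj]

/-- The fundamental quasisymmetric function `F_{n,S}`, for `S ⊆ [n-1]`. -/
noncomputable def fund (n : ℕ) (S : Finset ℕ) : QSym := ⟨fundSeries n S, fundSeries_mem n S⟩

/-- The fundamental quasisymmetric function `F_L` of a composition. -/
noncomputable def fundComp (L : AnyComp) : QSym := fund L.1 (desOfComp L.2)

/-- The fundamental cyclic quasisymmetric function `F^cyc_{n,S}`, which is `1` for `n = 0`. -/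
noncomputable def cycFund (n : ℕ) (S : Finset ℕ) : QSym :=
  if n = 0 then 1
  else ∑ i ∈ Finset.Icc 1 n, fund n (cycShift n S i ∩ Finset.Icc 1 (n - 1))

/-- The span `cQSym⁻` of the `F^cyc_{n,S}` over all non-Escher subsets `S ⊆ [n]`, `n ≥ 0`. -/
noncomputable def cQSymMinus : Submodule ℚ QSym :=
  Submodule.span ℚ {f | ∃ n S, NonEscher n S ∧ f = cycFund n S}

/-- The sum `∑_{i ∈ [n]} φ(F_{n,(S+i) ∩ [n-1]})`, which is by convention `1` for `n = 0`: the
value that `φ_cst` takes at `F^cyc_{n,S}`. -/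
noncomputable def cycImage {A : Type*} [Ring A] [Algebra ℚ A] (φ : QSym →ₐ[ℚ] A)
    (n : ℕ) (S : Finset ℕ) : A :=
  if n = 0 then 1
  else ∑ i ∈ Finset.Icc 1 n, φ (fund n (cycShift n S i ∩ Finset.Icc 1 (n - 1)))

end CyclicShuffle

open CyclicShuffle

namespace CyclicShuffle

/-! Everything follows from one product rule. Let `CycPerm.fund` of a cyclic permutation be the sum
of F_{n, Des τ} over its linear representatives τ. Rotating a word shifts its cyclic descent set, so
this sum is F^cyc_{n, cDes π} (`LinPerm.cycFund_eq`). The rule says that the product for disjoint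
[π] and [σ] is the sum over their cyclic shuffles (`CycPerm.fund_mul_fund`). It follows from the
linear rule F_π F_σ = Σ F_τ (`fund_mul_fund`), because each linear representative of a cyclic
shuffle is a shuffle of exactly one pair of representatives, found by keeping only the letters of π,
or only those of σ.

The linear rule is a bijection. The coefficient of a monomial in F_{n, Des π} counts the colourings
of the letters for which sorting by colour, then by letter, spells π (`coeff_fund`). A colouring of
a shuffle splits by letters into colourings of π and σ; conversely, the union of two such colourings
sorts into exactly one shuffle.

Hence cQSym⁻ is closed under products, and φ_cst is the restriction of φ. If φ sends the function of
[π] to a value W of its class, then W inherits the product rule. When W is linearly independent, two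
equal products force every class to occur equally often among the two sets of shuffles, which is
cyclic shuffle-compatibility; and the linear extension of W is injective and multiplicative.
`CycStat.classMap` matches classes of cyclic permutations with classes of cyclic compositions. -/

/-! ## Colourings -/

/-- Letters coloured by natural numbers, ordered first by colour and then by letter. -/
abbrev ColoredLetter : Type := ℕ ×ₗ ℕ+

/-- The word of the letters of a set of coloured letters, in increasing order. -/
def sortedLetters (X : Finset ColoredLetter) : List ℕ+ :=
  (X.sort (· ≤ ·)).map fun p => (ofLex p).2

/-- The monomial recording how often each colour is used. -/
noncomputable def colorWeight (X : Finset ColoredLetter) : ℕ →₀ ℕ :=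
  ∑ p ∈ X, Finsupp.single (ofLex p).1 1

/-- The colourings of the letters of `π` for which the sorted word is `π` itself. -/
def colorings (π : LinPerm) (m : ℕ →₀ ℕ) : Set (Finset ColoredLetter) :=
  {X | sortedLetters X = π.word ∧ colorWeight X = m}

theorem mem_sortedLetters {X : Finset ColoredLetter} {a : ℕ+} :
    a ∈ sortedLetters X ↔ ∃ p ∈ X, (ofLex p).2 = a := by
  simp [sortedLetters]

/-- A filtered sorted list is still sorted and duplicate-free, so it is the sort of its own set.
This is why restricting a colouring to some letters spells the corresponding subword. -/
theorem sortedLetters_filter (X : Finset ColoredLetter) (P : ℕ+ → Prop) [DecidablePred P] :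
    sortedLetters (X.filter fun p => P (ofLex p).2) = (sortedLetters X).filter (P ·) := by
  have h : (X.filter fun p => P (ofLex p).2).sort (· ≤ ·) =
      (X.sort (· ≤ ·)).filter fun p => P (ofLex p).2 := by
    have hn : ((X.sort (· ≤ ·)).filter fun p => P (ofLex p).2).Nodup :=
      (X.sort_nodup (· ≤ ·)).filter _
    rw [← (List.toFinset_sort (· ≤ ·) hn).2 ((X.pairwise_sort (· ≤ ·)).filter _)]
    congr 1
    ext p
    simp
  rw [sortedLetters, h, sortedLetters, List.filter_map]
  rfl

theorem colorings_finite (π : LinPerm) (m : ℕ →₀ ℕ) : (colorings π m).Finite := by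
  classical
  refine ((m.support ×ˢ π.word.toFinset).map toLex.toEmbedding).powerset.finite_toSet.subset ?_
  rintro X ⟨h1, rfl⟩
  rw [Finset.mem_coe, Finset.mem_powerset]
  intro p hp
  refine Finset.mem_map.2 ⟨ofLex p, Finset.mem_product.2 ⟨?_, ?_⟩, rfl⟩
  · rw [Finsupp.mem_support_iff, colorWeight, Finsupp.finsetSum_apply]
    refine (Finset.sum_pos' (fun _ _ => Nat.zero_le _) ⟨p, hp, ?_⟩).ne'
    simp
  · rw [List.mem_toFinset, ← h1]
    exact mem_sortedLetters.2 ⟨p, hp, rfl⟩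

/-- The word `π` with its letters coloured by `w`. -/
def paint (π : LinPerm) (w : Fin π.length → ℕ) : List ColoredLetter :=
  List.ofFn fun i : Fin π.length => toLex (w i, π.word[(i : ℕ)]'i.2)

theorem map_snd_paint (π : LinPerm) (w : Fin π.length → ℕ) :
    (paint π w).map (fun p => (ofLex p).2) = π.word := by
  refine List.ext_getElem (by simp [paint, LinPerm.length]) fun i _ _ => ?_
  simp only [paint, List.getElem_map, List.getElem_ofFn]
  rfl

theorem nodup_paint (π : LinPerm) (w : Fin π.length → ℕ) : (paint π w).Nodup :=
  List.Nodup.of_map (fun p => (ofLex p).2) (by rw [map_snd_paint]; exact π.nodup)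

theorem colorWeight_paint (π : LinPerm) (w : Fin π.length → ℕ) :
    colorWeight (paint π w).toFinset = mono w fun _ => 1 := by
  rw [colorWeight, List.sum_toFinset _ (nodup_paint π w), paint, List.map_ofFn, List.sum_ofFn, mono]
  rfl

/-- The letters of `π` are distinct, so the colour of each position can be read off from the set. -/
theorem paint_toFinset_injective (π : LinPerm) :
    Function.Injective fun w : Fin π.length → ℕ => (paint π w).toFinset := by
  intro w w' h
  funext i
  have h1 : toLex (w i, π.word[(i : ℕ)]'i.2) ∈ (paint π w').toFinset := by
    refine (congrArg (_ ∈ ·) h).mp ?_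
    simp only [paint, List.mem_toFinset, List.mem_ofFn]
    exact ⟨i, rfl⟩
  simp only [paint, List.mem_toFinset, List.mem_ofFn] at h1
  obtain ⟨j, hj⟩ := h1
  have hj' := congrArg ofLex hj
  simp only [ofLex_toLex, Prod.mk.injEq] at hj'
  have : j = i := Fin.ext ((π.nodup.getElem_inj_iff).1 hj'.2)
  rw [← hj'.1, this]

theorem strictMono_of_lt_next {α : Type*} [Preorder α] {n : ℕ} {g : Fin n → α}
    (h : ∀ p q : Fin n, (p : ℕ) + 1 = q → g p < g q) : StrictMono g := by
  rintro ⟨p, hp⟩ ⟨q, hq⟩ hpq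
  rw [Fin.mk_lt_mk] at hpq
  induction q, hpq using Nat.le_induction with
  | base => exact h ⟨p, hp⟩ ⟨p + 1, hq⟩ rfl
  | succ k hk ih => exact (ih (by omega)).trans (h ⟨k, by omega⟩ ⟨k + 1, hq⟩ rfl)

theorem mem_des {π : LinPerm} {i : ℕ} (h0 : 0 < i) (h1 : i < π.length) :
    i ∈ π.des ↔ π.word[i]'h1 < π.word[i - 1]'(by change _ < π.length; omega) := by
  have h1' : i < π.word.length := h1
  have h2' : i - 1 < π.word.length := by omega
  have : i ≤ π.length - 1 := by omega
  simp only [LinPerm.des, Finset.mem_filter, Finset.mem_Icc, List.getD_eq_getElem _ _ h1',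
    List.getD_eq_getElem _ _ h2']
  exact and_iff_right ⟨h0, this⟩

/-- Neighbours of equal colour are compared by their letters, so a descent forces the colour to
increase strictly, while an ascent lets it stay. This turns the definition of F_{n,S} into a sorting
condition. -/
theorem pairwise_paint_iff (π : LinPerm) (w : Fin π.length → ℕ) :
    (paint π w).Pairwise (· ≤ ·) ↔
      Monotone w ∧ ∀ p q : Fin π.length, (p : ℕ) + 1 = q → (q : ℕ) ∈ π.des → w p < w q := by
  have hdes : ∀ p q : Fin π.length, (p : ℕ) + 1 = q →
      ((q : ℕ) ∈ π.des ↔ π.word[(q : ℕ)]'q.2 < π.word[(p : ℕ)]'p.2) := by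
    intro p q hpq
    rw [mem_des (by omega) q.2]
    simp only [← hpq, Nat.add_sub_cancel]
    rfl
  rw [paint, List.pairwise_ofFn]
  constructor
  · intro h
    refine ⟨monotone_iff_forall_lt.2 fun p q hpq => ?_, fun p q hpq hq => ?_⟩
    · rcases Prod.Lex.toLex_le_toLex.1 (h hpq) with h1 | h1
      · exact h1.le
      · exact h1.1.le
    · rcases Prod.Lex.toLex_le_toLex.1 (h (show p < q by rw [Fin.lt_def]; omega)) with h1 | h1
      · exact h1
      · exact absurd ((hdes p q hpq).1 hq) (not_lt.2 h1.2)
  · rintro ⟨hm, hs⟩ p q hpq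
    refine (strictMono_of_lt_next (g := fun i : Fin π.length =>
      (toLex (w i, π.word[(i : ℕ)]'i.2) : ColoredLetter)) (fun p q hpq => ?_) hpq).le
    have hle : w p ≤ w q := hm (by rw [Fin.le_def]; omega)
    rw [Prod.Lex.toLex_lt_toLex]
    by_cases hq : (q : ℕ) ∈ π.des
    · exact Or.inl (hs p q hpq hq)
    · rcases hle.lt_or_eq with h1 | h1
      · exact Or.inl h1
      · refine Or.inr ⟨h1, lt_of_le_of_ne (not_lt.1 fun h => hq ((hdes p q hpq).2 h)) fun h => ?_⟩
        have := π.nodup.getElem_inj_iff.1 h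
        omega

/-- Painting is inverted by sorting the set and reading off the colours. -/
theorem colorings_eq_image (π : LinPerm) (m : ℕ →₀ ℕ) :
    colorings π m =
      (fun w : Fin π.length → ℕ => (paint π w).toFinset) '' fundSeqs π.length π.des m := by
  ext X
  constructor
  · rintro ⟨h1, rfl⟩
    have hl : (X.sort (· ≤ ·)).length = π.length := by
      rw [LinPerm.length, ← h1, sortedLetters, List.length_map]
    have hp : paint π (fun i => (ofLex ((X.sort (· ≤ ·))[(i : ℕ)]'(hl.symm ▸ i.2))).1) =
        X.sort (· ≤ ·) := by
      refine List.ext_getElem (by simp [paint, hl]) fun i _ _ => ?_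
      simp only [paint, List.getElem_ofFn, ← h1, sortedLetters, List.getElem_map]
      rfl
    have hw := (pairwise_paint_iff π _).1 (hp.symm ▸ X.pairwise_sort (· ≤ ·))
    refine ⟨_, ⟨hw.1, hw.2, ?_⟩, (congrArg List.toFinset hp).trans (X.sort_toFinset _)⟩
    rw [← colorWeight_paint, hp, X.sort_toFinset]
  · rintro ⟨w, ⟨h1, h2, h3⟩, rfl⟩
    refine ⟨?_, (colorWeight_paint π w).trans h3⟩
    have := (List.toFinset_sort (· ≤ ·) (nodup_paint π w)).2 ((pairwise_paint_iff π w).2 ⟨h1, h2⟩)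
    rw [sortedLetters, this, map_snd_paint]

theorem coeff_fund (π : LinPerm) (m : ℕ →₀ ℕ) :
    MvPowerSeries.coeff m (fund π.length π.des : MvPowerSeries ℕ ℚ) =
      (colorings_finite π m).toFinset.card := by
  rw [← Set.ncard_eq_toFinset_card _ (colorings_finite π m), colorings_eq_image,
    Set.ncard_image_of_injective _ (paint_toFinset_injective π)]
  rfl

/-! ## The product of fundamental quasisymmetric functions -/

/-- `π` is a sublist of the filtered word, and the lengths agree since the letters of `σ` contribute
nothing. -/
theorem IsShuffle.filter_left {π σ τ : LinPerm} (h : IsShuffle π σ τ) :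
    τ.word.filter (· ∈ π.word) = π.word := by
  have h1 : π.word.Sublist (τ.word.filter (· ∈ π.word)) := by
    have := h.2.2.1.filter (· ∈ π.word)
    rwa [List.filter_eq_self.2 (by simp)] at this
  refine (h1.eq_of_length ?_).symm
  have h2 := (h.perm.filter (· ∈ π.word)).length_eq
  rw [← h2, List.filter_append, List.filter_eq_self.2 (by simp), List.filter_eq_nil_iff.2,
    List.append_nil]
  intro a ha hb
  exact h.1 (of_decide_eq_true hb) ha

theorem IsShuffle.symm {π σ τ : LinPerm} (h : IsShuffle π σ τ) : IsShuffle σ π τ :=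
  ⟨h.1.symm, h.2.1.trans (add_comm _ _), h.2.2.2, h.2.2.1⟩

theorem isShuffle_of_filter {π σ τ : LinPerm} (hd : π.Disj σ)
    (h : ∀ a ∈ τ.word, a ∈ π.word ∨ a ∈ σ.word)
    (h1 : τ.word.filter (· ∈ π.word) = π.word) (h2 : τ.word.filter (· ∈ σ.word) = σ.word) :
    IsShuffle π σ τ := by
  have s1 : π.word.Sublist τ.word := h1 ▸ List.filter_sublist
  have s2 : σ.word.Sublist τ.word := h2 ▸ List.filter_sublist
  refine ⟨hd, ?_, s1, s2⟩
  have hp : τ.word.Perm (π.word ++ σ.word) := by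
    refine (List.perm_ext_iff_of_nodup τ.nodup (List.Nodup.append π.nodup σ.nodup hd)).2
      fun a => ⟨fun ha => List.mem_append.2 (h a ha), fun ha => ?_⟩
    rcases List.mem_append.1 ha with ha | ha
    · exact s1.subset ha
    · exact s2.subset ha
  have := hp.length_eq
  rwa [List.length_append] at this

theorem mem_shuffles {π σ τ : LinPerm} : τ ∈ shuffles π σ ↔ IsShuffle π σ τ :=
  (finite_shuffles π σ).mem_toFinset

/-- The coloured letters whose letter occurs in `π`. -/
def restrictLetters (π : LinPerm) (Z : Finset ColoredLetter) : Finset ColoredLetter :=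
  Z.filter fun p => (ofLex p).2 ∈ π.word

theorem sortedLetters_restrictLetters (π : LinPerm) (Z : Finset ColoredLetter) :
    sortedLetters (restrictLetters π Z) = (sortedLetters Z).filter (· ∈ π.word) :=
  sortedLetters_filter Z (· ∈ π.word)

theorem restrictLetters_eq_self {π : LinPerm} {X : Finset ColoredLetter}
    (h : ∀ a ∈ sortedLetters X, a ∈ π.word) : restrictLetters π X = X :=
  Finset.filter_true_of_mem fun p hp => h _ (mem_sortedLetters.2 ⟨p, hp, rfl⟩)

theorem restrictLetters_eq_empty {π : LinPerm} {X : Finset ColoredLetter}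
    (h : ∀ a ∈ sortedLetters X, a ∉ π.word) : restrictLetters π X = ∅ :=
  Finset.filter_false_of_mem fun p hp => h _ (mem_sortedLetters.2 ⟨p, hp, rfl⟩)

theorem restrictLetters_union_self {π σ : LinPerm} {Z : Finset ColoredLetter}
    (h : ∀ a ∈ sortedLetters Z, a ∈ π.word ∨ a ∈ σ.word) :
    restrictLetters π Z ∪ restrictLetters σ Z = Z := by
  rw [restrictLetters, restrictLetters, ← Finset.filter_or]
  exact Finset.filter_true_of_mem fun p hp => h _ (mem_sortedLetters.2 ⟨p, hp, rfl⟩)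

theorem colorWeight_union {X Y : Finset ColoredLetter} (h : Disjoint X Y) :
    colorWeight (X ∪ Y) = colorWeight X + colorWeight Y :=
  Finset.sum_union h

theorem disjoint_of_sortedLetters {X Y : Finset ColoredLetter}
    (h : List.Disjoint (sortedLetters X) (sortedLetters Y)) : Disjoint X Y :=
  Finset.disjoint_left.2 fun p hp hq =>
    h (mem_sortedLetters.2 ⟨p, hp, rfl⟩) (mem_sortedLetters.2 ⟨p, hq, rfl⟩)

theorem nodup_sortedLetters_union {X Y : Finset ColoredLetter}
    (hX : (sortedLetters X).Nodup) (hY : (sortedLetters Y).Nodup)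
    (h : List.Disjoint (sortedLetters X) (sortedLetters Y)) : (sortedLetters (X ∪ Y)).Nodup := by
  have key : ∀ {X : Finset ColoredLetter}, (sortedLetters X).Nodup →
      ∀ p ∈ X, ∀ q ∈ X, (ofLex p).2 = (ofLex q).2 → p = q := fun {X} hX p hp q hq hpq =>
    List.inj_on_of_nodup_map hX ((X.mem_sort _).2 hp) ((X.mem_sort _).2 hq) hpq
  refine List.Nodup.map_on (fun p hp q hq hpq => ?_) (Finset.sort_nodup _ _)
  rw [Finset.mem_sort, Finset.mem_union] at hp hq
  rcases hp with hp | hp <;> rcases hq with hq | hq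
  · exact key hX p hp q hq hpq
  · exact (h (mem_sortedLetters.2 ⟨p, hp, rfl⟩) (mem_sortedLetters.2 ⟨q, hq, hpq.symm⟩)).elim
  · exact (h (mem_sortedLetters.2 ⟨q, hq, rfl⟩) (mem_sortedLetters.2 ⟨p, hp, hpq⟩)).elim
  · exact key hY p hp q hq hpq

/-- Both sides have coefficients that count colourings: of a shuffle on the right, of `π` and `σ`
with total weight `m` on the left. Splitting by letters is a bijection between the two. -/
theorem fund_mul_fund {π σ : LinPerm} (h : π.Disj σ) :
    fund π.length π.des * fund σ.length σ.des = ∑ τ ∈ shuffles π σ, fund τ.length τ.des := by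
  classical
  refine Subtype.ext (MvPowerSeries.ext fun m => ?_)
  rw [MulMemClass.coe_mul, MvPowerSeries.coeff_mul, AddSubmonoidClass.coe_finsetSum, map_sum]
  simp only [coeff_fund]
  norm_cast
  simp only [← Finset.card_product]
  rw [← Finset.card_sigma, ← Finset.card_sigma]
  symm
  refine Finset.card_nbij (fun z => ⟨(colorWeight (restrictLetters π z.2),
    colorWeight (restrictLetters σ z.2)), (restrictLetters π z.2, restrictLetters σ z.2)⟩) ?_ ?_ ?_
  · rintro ⟨τ, Z⟩ hz
    simp only [Finset.coe_sigma, Set.mem_sigma_iff, Finset.mem_coe, mem_shuffles,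
      Set.Finite.mem_toFinset] at hz
    obtain ⟨hτ, hZ, rfl⟩ := hz
    have e1 := sortedLetters_restrictLetters π Z
    have e2 := sortedLetters_restrictLetters σ Z
    rw [hZ, hτ.filter_left] at e1
    rw [hZ, hτ.symm.filter_left] at e2
    simp only [Finset.coe_sigma, Set.mem_sigma_iff, Finset.mem_coe, Finset.mem_product,
      Set.Finite.mem_toFinset, Finset.HasAntidiagonal.mem_antidiagonal]
    refine ⟨?_, ⟨e1, rfl⟩, e2, rfl⟩
    rw [← colorWeight_union, restrictLetters_union_self]
    · intro a ha
      rw [hZ] at ha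
      exact List.mem_append.1 (hτ.perm.symm.subset ha)
    · exact disjoint_of_sortedLetters (by rw [e1, e2]; exact h)
  · rintro ⟨τ, Z⟩ hz ⟨τ', Z'⟩ hz' he
    simp only [Finset.coe_sigma, Set.mem_sigma_iff, Finset.mem_coe, mem_shuffles,
      Set.Finite.mem_toFinset] at hz hz'
    obtain ⟨hτ, hZ, -⟩ := hz
    obtain ⟨hτ', hZ', -⟩ := hz'
    simp only [Sigma.mk.injEq, heq_eq_eq, Prod.mk.injEq] at he
    -- The set is the union of its two restrictions, and it determines the shuffle as its sorted
    -- word.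
    have hZZ : Z = Z' := by
      rw [← restrictLetters_union_self (π := π) (σ := σ) (Z := Z),
        ← restrictLetters_union_self (π := π) (σ := σ) (Z := Z'), he.2.1, he.2.2]
      · intro a ha
        rw [hZ'] at ha
        exact List.mem_append.1 (hτ'.perm.symm.subset ha)
      · intro a ha
        rw [hZ] at ha
        exact List.mem_append.1 (hτ.perm.symm.subset ha)
    subst hZZ
    have : τ = τ' := LinPerm.ext (hZ.symm.trans hZ')
    rw [this]
  · rintro ⟨⟨p, q⟩, X, Y⟩ hz
    simp only [Finset.coe_sigma, Set.mem_sigma_iff, Finset.mem_coe, Finset.mem_product,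
      Set.Finite.mem_toFinset, Finset.HasAntidiagonal.mem_antidiagonal] at hz
    obtain ⟨rfl, ⟨hX, rfl⟩, hY, rfl⟩ := hz
    have hXY : List.Disjoint (sortedLetters X) (sortedLetters Y) := by rw [hX, hY]; exact h
    -- The only possible preimage: the shuffle must be the word that the union spells.
    let τ : LinPerm := ⟨sortedLetters (X ∪ Y), nodup_sortedLetters_union (hX ▸ π.nodup)
      (hY ▸ σ.nodup) hXY⟩
    have r1 : restrictLetters π (X ∪ Y) = X := by
      rw [restrictLetters, Finset.filter_union]
      change restrictLetters π X ∪ restrictLetters π Y = X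
      rw [restrictLetters_eq_self (by simp [hX]), restrictLetters_eq_empty, Finset.union_empty]
      rw [hY]
      exact fun a ha hb => h hb ha
    have r2 : restrictLetters σ (X ∪ Y) = Y := by
      rw [restrictLetters, Finset.filter_union]
      change restrictLetters σ X ∪ restrictLetters σ Y = Y
      rw [restrictLetters_eq_self (X := Y) (by simp [hY]), restrictLetters_eq_empty,
        Finset.empty_union]
      rw [hX]
      exact fun a ha hb => h ha hb
    have hτ : IsShuffle π σ τ := by
      refine isShuffle_of_filter h (fun a ha => ?_) ?_ ?_
      · obtain ⟨p, hp, rfl⟩ := mem_sortedLetters.1 ha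
        rw [← hX, ← hY]
        exact (Finset.mem_union.1 hp).imp (fun hp => mem_sortedLetters.2 ⟨p, hp, rfl⟩)
          fun hp => mem_sortedLetters.2 ⟨p, hp, rfl⟩
      · exact (sortedLetters_restrictLetters π (X ∪ Y)).symm.trans (by rw [r1, hX])
      · exact (sortedLetters_restrictLetters σ (X ∪ Y)).symm.trans (by rw [r2, hY])
    refine ⟨⟨τ, X ∪ Y⟩, ?_, ?_⟩
    · simp only [Finset.coe_sigma, Set.mem_sigma_iff, Finset.mem_coe, mem_shuffles,
        Set.Finite.mem_toFinset]
      exact ⟨hτ, rfl, colorWeight_union (disjoint_of_sortedLetters hXY)⟩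
    · simp only [r1, r2]

/-! ## Representatives of a cyclic permutation -/

theorem finite_reps (c : CycPerm) : {τ : LinPerm | τ.cyc = c}.Finite := by
  obtain ⟨π, rfl⟩ := c.exists_rep
  exact (finite_perm π.word).subset fun τ h => (LinPerm.perm_of_cyc_eq h).symm

/-- The linear permutations representing a cyclic permutation. -/
noncomputable def CycPerm.reps (c : CycPerm) : Finset LinPerm := (finite_reps c).toFinset

theorem CycPerm.mem_reps {c : CycPerm} {τ : LinPerm} : τ ∈ c.reps ↔ τ.cyc = c :=
  (finite_reps c).mem_toFinset

theorem LinPerm.cyc_eq_iff {π σ : LinPerm} : π.cyc = σ.cyc ↔ π.word ~r σ.word :=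
  Subtype.ext_iff.trans Cycle.coe_eq_coe

/-- The rotation of a linear permutation. -/
def LinPerm.rotate (π : LinPerm) (k : ℕ) : LinPerm :=
  ⟨π.word.rotate k, List.nodup_rotate.2 π.nodup⟩

theorem LinPerm.length_rotate (π : LinPerm) (k : ℕ) : (π.rotate k).length = π.length :=
  List.length_rotate _ _

theorem getD_rotate {l : List ℕ+} {j : ℕ} (k : ℕ) (h : j < l.length) :
    (l.rotate k).getD j 1 = l.getD ((j + k) % l.length) 1 := by
  rw [List.getD_eq_getElem _ _ (by rwa [List.length_rotate]), List.getElem_rotate,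
    List.getD_eq_getElem _ _ (Nat.mod_lt _ (by omega))]

theorem LinPerm.mem_cDes {π : LinPerm} {i : ℕ} : i ∈ π.cDes ↔ (1 ≤ i ∧ i ≤ π.length) ∧
    π.word.getD (i % π.length) 1 < π.word.getD (i - 1) 1 := by
  simp only [LinPerm.cDes, Finset.mem_filter, Finset.mem_Icc]

theorem LinPerm.cDes_subset (π : LinPerm) : π.cDes ⊆ Finset.Icc 1 π.length :=
  Finset.filter_subset _ _

theorem LinPerm.des_eq_cDes_inter (π : LinPerm) :
    π.des = π.cDes ∩ Finset.Icc 1 (π.length - 1) := by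
  ext i
  simp only [LinPerm.des, Finset.mem_inter, LinPerm.mem_cDes, Finset.mem_filter, Finset.mem_Icc]
  constructor
  · rintro ⟨h, h'⟩
    rw [Nat.mod_eq_of_lt (by omega)]
    exact ⟨⟨by omega, h'⟩, h⟩
  · rintro ⟨⟨_, h'⟩, h⟩
    rw [Nat.mod_eq_of_lt (by omega)] at h'
    exact ⟨h, h'⟩

/-- Rotating left by n - i moves every letter i places to the right around the circle, and the
cyclic descents move with it. -/
theorem LinPerm.cDes_rotate (π : LinPerm) {i : ℕ} (hi : i ≤ π.length) :
    (π.rotate (π.length - i)).cDes = cycShift π.length π.cDes i := by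
  rcases Nat.eq_zero_or_pos π.length with h0 | hpos
  · have h1 : π.cDes = ∅ := by simp [LinPerm.cDes, h0]
    have h2 : (π.rotate (π.length - i)).cDes = ∅ := by
      simp [LinPerm.cDes, LinPerm.length_rotate, h0]
    rw [h1, h2, cycShift, Finset.image_empty]
  -- Descents are numbered from 1 and letters from 0, which explains the `x - 1` inside the
  -- remainder and the `+ 1` outside.
  have key : ∀ x, 1 ≤ x → x ≤ π.length →
      (x ∈ (π.rotate (π.length - i)).cDes ↔ (x - 1 + (π.length - i)) % π.length + 1 ∈ π.cDes) := by
    intro x h1 h2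
    have e : ((x - 1 + (π.length - i)) % π.length + 1) % π.length =
        (x % π.length + (π.length - i)) % π.length := by
      rw [Nat.mod_add_mod, Nat.mod_add_mod]
      congr 1
      omega
    have hlt := Nat.mod_lt (x - 1 + (π.length - i)) hpos
    have hx := Nat.mod_lt x hpos
    rw [LinPerm.mem_cDes, LinPerm.mem_cDes, LinPerm.length_rotate, LinPerm.rotate,
      getD_rotate _ hx, getD_rotate _ (show x - 1 < π.word.length by change _ < π.length; omega),
      e, Nat.add_sub_cancel]
    exact and_congr_left fun _ => ⟨fun _ => ⟨by omega, by omega⟩, fun _ => ⟨h1, h2⟩⟩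
  ext x
  simp only [cycShift, Finset.mem_image]
  constructor
  · intro hx
    have h := LinPerm.mem_cDes.1 hx
    rw [LinPerm.length_rotate] at h
    refine ⟨_, (key x h.1.1 h.1.2).1 hx, ?_⟩
    have : (x - 1 + (π.length - i)) % π.length + 1 + i - 1 =
        (x - 1 + (π.length - i)) % π.length + i := by omega
    rw [this, Nat.mod_add_mod, add_assoc, Nat.sub_add_cancel hi, Nat.add_mod_right,
      Nat.mod_eq_of_lt (by omega)]
    omega
  · rintro ⟨s, hs, rfl⟩
    have h := LinPerm.mem_cDes.1 hs
    have hlt := Nat.mod_lt (s + i - 1) hpos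
    rw [key _ (by omega) (by omega), Nat.add_sub_cancel, Nat.mod_add_mod]
    have : s + i - 1 + (π.length - i) = s - 1 + π.length := by omega
    rw [this, Nat.add_mod_right, Nat.mod_eq_of_lt (by omega), Nat.sub_add_cancel h.1.1]
    exact hs

theorem fund_zero (S : Finset ℕ) : fund 0 S = 1 := by
  classical
  refine Subtype.ext (MvPowerSeries.ext fun m => ?_)
  rw [OneMemClass.coe_one, MvPowerSeries.coeff_one]
  change ((fundSeqs 0 S m).ncard : ℚ) = _
  split_ifs with h
  · have : fundSeqs 0 S m = {Fin.elim0} := by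
      ext w
      simp only [Set.mem_singleton_iff, Subsingleton.elim w Fin.elim0, iff_true]
      exact ⟨fun p => p.elim0, fun p => p.elim0, by simp [mono, h]⟩
    simp [this]
  · have : fundSeqs 0 S m = ∅ := by
      refine Set.eq_empty_of_forall_notMem ?_
      rintro w ⟨-, -, rfl⟩
      simp [mono] at h
    simp [this]

/-- The fundamental cyclic quasisymmetric function of a cyclic permutation: the sum of the
fundamental quasisymmetric functions of its representatives. -/
noncomputable def CycPerm.fund (c : CycPerm) : QSym :=
  ∑ τ ∈ c.reps, CyclicShuffle.fund τ.length τ.des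

/-- Since the letters are distinct, the n rotations of a nonempty word are distinct; each has as
descent set one of the shifts of `π.cDes`, cut down to [n-1]. -/
theorem LinPerm.cycFund_eq (π : LinPerm) : cycFund π.length π.cDes = π.cyc.fund := by
  rw [cycFund, CycPerm.fund]
  split_ifs with h0
  -- For n = 0 the sum over [n] would be empty, but the empty word is still one representative and
  -- contributes 1.
  · have hw : π.word = [] := List.length_eq_zero_iff.1 h0
    have : π.cyc.reps = {π} := by
      ext τ
      rw [CycPerm.mem_reps, Finset.mem_singleton]
      refine ⟨fun h => LinPerm.ext ?_, fun h => h ▸ rfl⟩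
      have := LinPerm.perm_of_cyc_eq h
      rw [hw] at this ⊢
      exact this.eq_nil
    rw [this, Finset.sum_singleton, h0, fund_zero]
  · refine Finset.sum_nbij (fun i => π.rotate (π.length - i)) ?_ ?_ ?_ ?_
    · intro i _
      rw [CycPerm.mem_reps, LinPerm.cyc_eq_iff]
      exact (List.IsRotated.symm ⟨_, rfl⟩)
    · intro i hi j hj hij
      rw [Finset.mem_coe, Finset.mem_Icc] at hi hj
      have h1 := π.nodup.rotate_congr (fun h => h0 (by rw [LinPerm.length, h]; rfl)) _ _
        (congrArg LinPerm.word hij)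
      change (π.length - i) % π.length = (π.length - j) % π.length at h1
      rw [Nat.mod_eq_of_lt (by omega), Nat.mod_eq_of_lt (by omega)] at h1
      omega
    · intro τ hτ
      rw [Finset.mem_coe, CycPerm.mem_reps] at hτ
      obtain ⟨k, hk⟩ := LinPerm.cyc_eq_iff.1 hτ.symm
      have hlt : k % π.length < π.length := Nat.mod_lt _ (by omega)
      -- Reducing `k` modulo n puts this index in [1, n].
      refine ⟨π.length - k % π.length, ?_, LinPerm.ext ?_⟩
      · rw [Finset.mem_coe, Finset.mem_Icc]
        omega
      · change π.word.rotate (π.length - (π.length - k % π.length)) = τ.word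
        rw [Nat.sub_sub_self hlt.le, ← hk]
        exact List.rotate_mod _ _
    · intro i hi
      rw [Finset.mem_Icc] at hi
      rw [LinPerm.des_eq_cDes_inter, LinPerm.length_rotate, LinPerm.cDes_rotate _ hi.2]

/-! ## The product of fundamental cyclic quasisymmetric functions -/

/-- A rotation exchanges the two factors of a concatenation, and filtering respects concatenation.
-/
theorem isRotated_filter {α : Type*} {l l' : List α} (h : l ~r l') (p : α → Bool) :
    l.filter p ~r l'.filter p := by
  obtain ⟨k, rfl⟩ := h
  rw [List.rotate_eq_drop_append_take_mod, List.filter_append]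
  conv_lhs => rw [← List.take_append_drop (k % l.length) l, List.filter_append]
  exact List.isRotated_append

theorem CycPerm.Disj.of_reps {c d : CycPerm} (h : c.Disj d) {π σ : LinPerm} (hπ : π.cyc = c)
    (hσ : σ.cyc = d) : π.Disj σ := by
  subst hπ hσ
  exact fun a ha hb => h a ha hb

theorem mem_word_iff_of_cyc_eq {π σ : LinPerm} (h : π.cyc = σ.cyc) (a : ℕ+) :
    a ∈ π.word ↔ a ∈ σ.word :=
  (LinPerm.perm_of_cyc_eq h).mem_iff

/-- The representative is what remains of `τ` on its letters, and the set of letters depends only on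
the cyclic class. This is the uniqueness needed to regroup the cyclic product. -/
theorem IsShuffle.eq_of_cyc_eq {π σ π' σ' τ : LinPerm} (h : IsShuffle π σ τ)
    (h' : IsShuffle π' σ' τ) (hc : π.cyc = π'.cyc) : π = π' := by
  refine LinPerm.ext ?_
  rw [← h.filter_left, ← h'.filter_left]
  simp only [mem_word_iff_of_cyc_eq hc]

theorem mem_cycShuffles {c d t : CycPerm} : t ∈ cycShuffles c d ↔ IsCycShuffle c d t :=
  (finite_cycShuffles c d).mem_toFinset

/-- Every representative of a cyclic shuffle is a shuffle of representatives. -/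
theorem IsCycShuffle.exists_isShuffle {c d : CycPerm} {τ : LinPerm}
    (h : IsCycShuffle c d τ.cyc) :
    ∃ π σ : LinPerm, π.cyc = c ∧ σ.cyc = d ∧ IsShuffle π σ τ := by
  obtain ⟨π, σ, ρ, rfl, rfl, hρ, hs⟩ := h
  have hrot : ρ.word ~r τ.word := LinPerm.cyc_eq_iff.1 hρ
  have r1 := isRotated_filter hrot (· ∈ π.word)
  have r2 := isRotated_filter hrot (· ∈ σ.word)
  rw [hs.filter_left] at r1
  rw [hs.symm.filter_left] at r2
  -- The original shuffle `ρ` is a rotation of `τ`, so the subwords of `τ` on the two sets of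
  -- letters are rotations of `π` and `σ`.
  let π' : LinPerm := ⟨τ.word.filter (· ∈ π.word), τ.nodup.filter _⟩
  let σ' : LinPerm := ⟨τ.word.filter (· ∈ σ.word), τ.nodup.filter _⟩
  have hπ : π'.cyc = π.cyc := LinPerm.cyc_eq_iff.2 r1.symm
  have hσ : σ'.cyc = σ.cyc := LinPerm.cyc_eq_iff.2 r2.symm
  refine ⟨π', σ', hπ, hσ, isShuffle_of_filter ?_ ?_ ?_ ?_⟩
  · intro a ha hb
    exact hs.1 ((mem_word_iff_of_cyc_eq hπ a).1 ha) ((mem_word_iff_of_cyc_eq hσ a).1 hb)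
  · intro a ha
    rw [mem_word_iff_of_cyc_eq hπ, mem_word_iff_of_cyc_eq hσ]
    exact List.mem_append.1 (hs.perm.symm.subset (hrot.perm.symm.subset ha))
  · simp only [mem_word_iff_of_cyc_eq hπ]
    rfl
  · simp only [mem_word_iff_of_cyc_eq hσ]
    rfl

/-- Expand both sums and apply the linear rule to each pair of representatives. The resulting
shuffles are the representatives of all cyclic shuffles, each obtained from exactly one pair. -/
theorem CycPerm.fund_mul_fund {c d : CycPerm} (hd : c.Disj d) :
    c.fund * d.fund = ∑ t ∈ cycShuffles c d, t.fund := by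
  have h1 : ∀ p ∈ c.reps ×ˢ d.reps,
      CyclicShuffle.fund p.1.length p.1.des * CyclicShuffle.fund p.2.length p.2.des =
        ∑ τ ∈ shuffles p.1 p.2, CyclicShuffle.fund τ.length τ.des := fun p hp => by
    rw [Finset.mem_product, CycPerm.mem_reps, CycPerm.mem_reps] at hp
    exact CyclicShuffle.fund_mul_fund (hd.of_reps hp.1 hp.2)
  simp only [CycPerm.fund]
  rw [Finset.sum_mul_sum, ← Finset.sum_product',
    Finset.sum_congr rfl h1, Finset.sum_sigma', Finset.sum_sigma']
  refine Finset.sum_nbij (fun z => ⟨z.2.cyc, z.2⟩) ?_ ?_ ?_ fun _ _ => rfl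
  · rintro ⟨⟨π', σ'⟩, τ⟩ hz
    simp only [Finset.mem_sigma, Finset.mem_product, CycPerm.mem_reps, mem_shuffles,
      mem_cycShuffles] at hz ⊢
    exact ⟨⟨π', σ', τ, hz.1.1, hz.1.2, rfl, hz.2⟩, trivial⟩
  · rintro ⟨⟨π₁, σ₁⟩, τ₁⟩ hz₁ ⟨⟨π₂, σ₂⟩, τ₂⟩ hz₂ he
    simp only [Finset.mem_coe, Finset.mem_sigma, Finset.mem_product, CycPerm.mem_reps,
      mem_shuffles] at hz₁ hz₂
    have hτ : τ₁ = τ₂ := congrArg (fun z : (_ : CycPerm) × LinPerm => z.2) he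
    subst hτ
    have e1 := hz₁.2.eq_of_cyc_eq hz₂.2 (hz₁.1.1.trans hz₂.1.1.symm)
    have e2 := hz₁.2.symm.eq_of_cyc_eq hz₂.2.symm (hz₁.1.2.trans hz₂.1.2.symm)
    subst e1 e2
    rfl
  · rintro ⟨t, τ⟩ hz
    simp only [Finset.mem_coe, Finset.mem_sigma, CycPerm.mem_reps, mem_cycShuffles] at hz
    obtain ⟨hz, rfl⟩ := hz
    obtain ⟨π', σ', hπ, hσ, hs⟩ := hz.exists_isShuffle
    refine ⟨⟨(π', σ'), τ⟩, ?_, rfl⟩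
    simp only [Finset.mem_coe, Finset.mem_sigma, Finset.mem_product, CycPerm.mem_reps,
      mem_shuffles]
    exact ⟨⟨hπ, hσ⟩, hs⟩

/-! ## Sizes of cyclic descent compositions -/

/-- The differences telescope. With `c` = n + `a`, the wrap-around entry of a cyclic composition,
the sum is n. -/
theorem sum_zipWith_sub (a c : ℕ) (t : List ℕ) (hs : (a :: t).Pairwise (· ≤ ·))
    (hc : ∀ b ∈ a :: t, b ≤ c) :
    (List.zipWith (fun a b => b - a) (a :: t) (t ++ [c])).sum = c - a := by
  induction t generalizing a with
  | nil => simp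
  | cons b t ih =>
    have hab : a ≤ b := (List.pairwise_cons.1 hs).1 b (by simp)
    have hbc : b ≤ c := hc b (by simp)
    rw [List.cons_append, List.zipWith_cons_cons, List.sum_cons,
      ih b (List.pairwise_cons.1 hs).2 fun x hx => hc x (List.mem_cons_of_mem _ hx)]
    omega

/-- Without a cyclic descent the letters would increase weakly all the way round, so the last would
equal the first. An empty set has to be excluded because its list of differences would sum to 0
instead of n. -/
theorem LinPerm.cDes_nonempty (π : LinPerm) (h : 2 ≤ π.length) : π.cDes.Nonempty := by
  by_contra hS
  rw [Finset.not_nonempty_iff_eq_empty] at hS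
  have hle : ∀ i, 1 ≤ i → i ≤ π.length →
      π.word.getD (i - 1) 1 ≤ π.word.getD (i % π.length) 1 := by
    intro i h1 h2
    by_contra hi
    have : i ∈ π.cDes := LinPerm.mem_cDes.2 ⟨⟨h1, h2⟩, not_le.1 hi⟩
    simp [hS] at this
  have h0 : ∀ j, j < π.length → π.word.getD 0 1 ≤ π.word.getD j 1 := by
    intro j
    induction j with
    | zero => exact fun _ => le_rfl
    | succ j ih =>
      intro hj
      have := hle (j + 1) (by omega) hj.le
      rw [Nat.mod_eq_of_lt hj, Nat.add_sub_cancel] at this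
      exact (ih (by omega)).trans this
  have h1 := hle π.length (by omega) le_rfl
  rw [Nat.mod_self] at h1
  have h2 := le_antisymm h1 (h0 (π.length - 1) (by omega))
  have hl : 0 < π.word.length := by change 0 < π.length; omega
  have hl' : π.length - 1 < π.word.length := by change _ < π.length; omega
  rw [List.getD_eq_getElem _ _ hl, List.getD_eq_getElem _ _ hl', π.nodup.getElem_inj_iff] at h2
  omega

theorem LinPerm.sum_cCompList (π : LinPerm) : (cCompList π.length π.cDes).sum = π.length := by
  rw [cCompList]
  split_ifs with h0 h1
  · simp [h0]
  · simp [h1]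
  · obtain ⟨x, hx⟩ := π.cDes_nonempty (by omega)
    have hp := π.cDes.pairwise_sort (· ≤ ·)
    have hm : ∀ b ∈ π.cDes.sort (· ≤ ·), b ≤ π.length := fun b hb =>
      (Finset.mem_Icc.1 (π.cDes_subset ((Finset.mem_sort _).1 hb))).2
    have hx' : x ∈ π.cDes.sort (· ≤ ·) := (Finset.mem_sort _).2 hx
    generalize π.cDes.sort (· ≤ ·) = s at hp hm hx'
    cases s with
    | nil => simp at hx'
    | cons a t =>
      refine (sum_zipWith_sub a _ t hp fun b hb => (hm b hb).trans (Nat.le_add_right _ _)).trans ?_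
      simp

/-- This reconciles "same size" for cyclic compositions with "same length" for cyclic permutations.
-/
theorem size_neCComp (π : LinPerm) : (neCComp π.length π.cDes π.nonEscher).size = π.length := by
  change (Cycle.toMultiset (cCompList π.length π.cDes : Cycle ℕ)).sum = π.length
  rw [Cycle.coe_toMultiset, Multiset.sum_coe, LinPerm.sum_cCompList]

/-! ## The subalgebra `cQSym⁻` -/

/-- Adding a bound on the letters of `c` to every letter of `d` makes the two disjoint and keeps the
cyclic descent set, which determines the function. It makes the product rule available for every
pair of generators. -/
theorem CycPerm.exists_disj_fund_eq (c d : CycPerm) :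
    ∃ d' : CycPerm, c.Disj d' ∧ d'.fund = d.fund := by
  obtain ⟨π, rfl⟩ := c.exists_rep
  obtain ⟨σ, rfl⟩ := d.exists_rep
  obtain ⟨N, hN⟩ := π.word.toFinset.exists_le
  let σ' : LinPerm := ⟨σ.word.map (· + N), σ.nodup.map (add_left_injective N)⟩
  have hl : σ'.length = σ.length := List.length_map _
  have hg : ∀ i, i < σ.length → σ'.word.getD i 1 = σ.word.getD i 1 + N := by
    intro i hi
    have hi' : i < σ.word.length := hi
    simp only [σ', List.getD_eq_getElem?_getD, List.getElem?_map, List.getElem?_eq_getElem hi',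
      Option.map_some, Option.getD_some]
  have hS : σ'.cDes = σ.cDes := by
    ext i
    rw [LinPerm.mem_cDes, LinPerm.mem_cDes, hl]
    refine and_congr_right fun hi => ?_
    rw [hg _ (Nat.mod_lt _ (by omega)), hg _ (by omega), add_lt_add_iff_right]
  refine ⟨σ'.cyc, fun a ha hb => ?_, ?_⟩
  · have ha' : a ∈ π.word := ha
    have hb' : a ∈ σ.word.map (· + N) := hb
    obtain ⟨b, _, rfl⟩ := List.mem_map.1 hb'
    exact absurd (hN _ (List.mem_toFinset.2 ha')) (not_le.2 (PNat.lt_add_left N b))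
  · rw [← LinPerm.cycFund_eq, ← LinPerm.cycFund_eq, hl, hS]

theorem cQSymMinus_eq_span : cQSymMinus = Submodule.span ℚ (Set.range CycPerm.fund) := by
  rw [cQSymMinus]
  congr 1
  ext f
  constructor
  · rintro ⟨_, _, ⟨π, rfl, rfl⟩, rfl⟩
    exact ⟨π.cyc, π.cycFund_eq.symm⟩
  · rintro ⟨c, rfl⟩
    obtain ⟨π, rfl⟩ := c.exists_rep
    exact ⟨_, _, π.nonEscher, π.cycFund_eq.symm⟩

theorem CycPerm.fund_empty : LinPerm.empty.cyc.fund = 1 := by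
  rw [← LinPerm.cycFund_eq]
  exact if_pos rfl

theorem one_mem_cQSymMinus : (1 : QSym) ∈ cQSymMinus := by
  rw [cQSymMinus_eq_span, ← CycPerm.fund_empty]
  exact Submodule.subset_span ⟨_, rfl⟩

theorem mul_mem_cQSymMinus {f g : QSym} (hf : f ∈ cQSymMinus) (hg : g ∈ cQSymMinus) :
    f * g ∈ cQSymMinus := by
  rw [cQSymMinus_eq_span] at *
  have h := Submodule.mul_mem_mul hf hg
  rw [Submodule.span_mul_span] at h
  refine Submodule.span_le.2 ?_ h
  rintro _ ⟨_, ⟨c, rfl⟩, _, ⟨d, rfl⟩, rfl⟩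
  obtain ⟨d', hd, he⟩ := c.exists_disj_fund_eq d
  change c.fund * d.fund ∈ Submodule.span ℚ (Set.range CycPerm.fund)
  rw [← he, CycPerm.fund_mul_fund hd]
  exact Submodule.sum_mem _ fun t _ => Submodule.subset_span ⟨t, rfl⟩

/-- The subalgebra `cQSym⁻` of `QSym`. -/
noncomputable def cQSymSubalgebra : Subalgebra ℚ QSym :=
  cQSymMinus.toSubalgebra one_mem_cQSymMinus fun _ _ => mul_mem_cQSymMinus

theorem cycFund_mem {n : ℕ} {S : Finset ℕ} (h : NonEscher n S) : cycFund n S ∈ cQSymSubalgebra :=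
  Submodule.subset_span ⟨n, S, h, rfl⟩

theorem map_cycFund {A : Type*} [Ring A] [Algebra ℚ A] (φ : QSym →ₐ[ℚ] A) (n : ℕ)
    (S : Finset ℕ) : φ (cycFund n S) = cycImage φ n S := by
  rw [cycFund, cycImage]
  split_ifs
  · exact map_one φ
  · exact map_sum φ _ _

/-- The restriction of `φ` has the required values, and any other such map agrees with it because
the generators span. -/
theorem existsUnique_algHom_cQSym {A : Type*} [Ring A] [Algebra ℚ A] (φ : QSym →ₐ[ℚ] A) :
    ∃! φc : cQSymSubalgebra →ₐ[ℚ] A, ∀ (n : ℕ) (S : Finset ℕ), NonEscher n S →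
      ∃ hF : cycFund n S ∈ cQSymSubalgebra, φc ⟨cycFund n S, hF⟩ = cycImage φ n S := by
  refine ⟨φ.comp cQSymSubalgebra.val, fun n S h => ⟨cycFund_mem h, map_cycFund φ n S⟩,
    fun ψ hψ => AlgHom.ext ?_⟩
  rintro ⟨f, hf⟩
  change ψ ⟨f, hf⟩ = φ f
  induction hf using Submodule.span_induction with
  | mem f hf =>
    obtain ⟨n, S, h, rfl⟩ := hf
    rw [map_cycFund]
    exact (hψ n S h).2
  | zero => rw [map_zero]; exact map_zero ψ
  | add f g hf hg h1 h2 =>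
    rw [map_add, ← h1, ← h2]
    exact map_add ψ ⟨f, hf⟩ ⟨g, hg⟩
  | smul r f hf h1 =>
    rw [map_smul, ← h1]
    exact map_smul ψ r ⟨f, hf⟩

/-! ## Classes of cyclic permutations and of cyclic compositions -/

variable {β : Type*} {cst : CycStat β}

/-- The permutation chosen inside `onComp` has the same cyclic descent composition as `π`, hence the
same value of `cst`. Both equivalences therefore compare length and value. -/
theorem CycStat.compClass_eq_iff (hcst : cst.IsCyclicDescentStat) {π σ : LinPerm} :
    cst.compClass (neCComp π.length π.cDes π.nonEscher) =
        cst.compClass (neCComp σ.length σ.cDes σ.nonEscher) ↔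
      cst.permClass π.cyc = cst.permClass σ.cyc := by
  have hval : ∀ π : LinPerm, cst.onComp (neCComp π.length π.cDes π.nonEscher) =
      cst.toFun π.cyc := fun π =>
    hcst _ _ (neCComp π.length π.cDes π.nonEscher).exists_perm.choose_spec
  refine (Quotient.eq (r := cst.compSetoid)).trans (Iff.trans ?_
    (Quotient.eq (r := cst.permSetoid)).symm)
  change (NECycComp.size _, cst.onComp _) = (NECycComp.size _, cst.onComp _) ↔ _
  rw [size_neCComp, size_neCComp, hval, hval]
  rfl

/-- The class of cyclic descent compositions of a class of cyclic permutations. -/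
noncomputable def CycStat.classMap (cst : CycStat β) (hcst : cst.IsCyclicDescentStat) :
    cst.PermClass → cst.CompClass :=
  Quotient.lift (s := cst.permSetoid)
    (fun c => cst.compClass (neCComp _ _ c.exists_rep.choose.nonEscher)) fun c d h => by
      refine (CycStat.compClass_eq_iff hcst).2 ?_
      rw [c.exists_rep.choose_spec, d.exists_rep.choose_spec]
      exact Quotient.sound (s := cst.permSetoid) h

theorem CycStat.classMap_permClass (hcst : cst.IsCyclicDescentStat) (π : LinPerm) :
    cst.classMap hcst (cst.permClass π.cyc) =
      cst.compClass (neCComp π.length π.cDes π.nonEscher) := by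
  refine (CycStat.compClass_eq_iff hcst).2 ?_
  rw [π.cyc.exists_rep.choose_spec]

theorem CycStat.exists_permClass_eq (x : cst.PermClass) :
    ∃ π : LinPerm, cst.permClass π.cyc = x := by
  obtain ⟨c, rfl⟩ := Quotient.exists_rep x
  obtain ⟨π, rfl⟩ := c.exists_rep
  exact ⟨π, rfl⟩

theorem CycStat.classMap_bijective (hcst : cst.IsCyclicDescentStat) :
    Function.Bijective (cst.classMap hcst) := by
  constructor
  · intro x y h
    obtain ⟨π, rfl⟩ := CycStat.exists_permClass_eq x
    obtain ⟨σ, rfl⟩ := CycStat.exists_permClass_eq y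
    rw [CycStat.classMap_permClass, CycStat.classMap_permClass] at h
    exact (CycStat.compClass_eq_iff hcst).1 h
  · intro y
    obtain ⟨⟨_, _, _, ⟨π, rfl, rfl⟩, rfl⟩, rfl⟩ := Quotient.exists_rep y
    exact ⟨cst.permClass π.cyc, CycStat.classMap_permClass hcst π⟩

/-! ## Algebra homomorphisms that realize the classes of a cyclic statistic -/

section Realization

variable {A : Type*} [Ring A] [Algebra ℚ A] {φ : QSym →ₐ[ℚ] A} {W : cst.PermClass → A}

/-- The image of the cyclic product rule under `φ`. -/
theorem sum_cycShuffles_eq (hW : ∀ c, φ c.fund = W (cst.permClass c)) {c d : CycPerm}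
    (h : c.Disj d) : ∑ t ∈ cycShuffles c d, W (cst.permClass t) =
      W (cst.permClass c) * W (cst.permClass d) := by
  simp only [← hW]
  rw [← map_mul, CycPerm.fund_mul_fund h, map_sum]

theorem cyclicShuffleCompatible_of_linearIndependent
    (hW : ∀ c, φ c.fund = W (cst.permClass c)) (hli : LinearIndependent ℚ W) :
    cst.CyclicShuffleCompatible := by
  classical
  intro c d c' d' hcd hcd' hc hd hc' hd'
  have e1 : cst.permClass c = cst.permClass c' :=
    Quotient.sound (s := cst.permSetoid) (Prod.ext hc' hc)
  have e2 : cst.permClass d = cst.permClass d' :=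
    Quotient.sound (s := cst.permSetoid) (Prod.ext hd' hd)
  have h1 := (sum_cycShuffles_eq hW hcd).trans
    ((by rw [e1, e2] : _ = _).trans (sum_cycShuffles_eq hW hcd').symm)
  -- Independence is applied to the formal sums of classes over the two sets of shuffles.
  have hlc : ∀ T : Finset CycPerm, Finsupp.linearCombination ℚ W
      (∑ t ∈ T, Finsupp.single (cst.permClass t) 1) = ∑ t ∈ T, W (cst.permClass t) := by
    intro T
    simp
  rw [← hlc, ← hlc] at h1
  have h2 := linearIndependent_iff_injective_finsuppLinearCombination.1 hli h1
  -- The coefficients are multiplicities, so equal formal sums give equal multisets of classes.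
  have hcount : ∀ (T : Finset CycPerm) (x : cst.PermClass),
      (∑ t ∈ T, Finsupp.single (cst.permClass t) (1 : ℚ)) x =
        ((T.val.map cst.permClass).count x : ℚ) := by
    intro T x
    rw [Finsupp.finsetSum_apply, Multiset.count_map]
    simp only [Finsupp.single_apply, Finset.sum_boole, eq_comm (a := x)]
    rfl
  have h3 : (cycShuffles c d).val.map cst.permClass = (cycShuffles c' d').val.map cst.permClass :=
    Multiset.ext.2 fun x => by
      have := DFunLike.congr_fun h2 x
      rw [hcount, hcount] at this
      exact_mod_cast this
  let value : cst.PermClass → β :=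
    Quotient.lift (s := cst.permSetoid) cst.toFun fun _ _ h => (Prod.mk.inj h).2
  have hvalue : ∀ T : Finset CycPerm,
      (T.val.map cst.permClass).map value = T.val.map cst.toFun := fun T =>
    Multiset.map_map value cst.permClass T.val
  rw [← hvalue, ← hvalue, h3]

/-- The linear map on the cyclic shuffle algebra with prescribed values on the classes. -/
noncomputable def CycStat.algLift (W : cst.PermClass → A) : cst.Alg →ₗ[ℚ] A :=
  (Finsupp.linearCombination ℚ W : (cst.PermClass →₀ ℚ) →ₗ[ℚ] A)

theorem CycStat.algLift_of (c : CycPerm) :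
    CycStat.algLift W (cst.of c) = W (cst.permClass c) := by
  change Finsupp.linearCombination ℚ W (Finsupp.single (cst.permClass c) 1) = _
  simp

/-- The chosen disjoint representatives do not matter here: the sum over their shuffles is a product
of values that depend only on the classes. -/
theorem CycStat.algLift_mulBasis (hW : ∀ c, φ c.fund = W (cst.permClass c))
    (x y : cst.PermClass) : CycStat.algLift W (cst.mulBasis x y) = W x * W y := by
  rw [CycStat.mulBasis, map_sum]
  simp only [CycStat.algLift_of]
  obtain ⟨hx, hy, hd⟩ := (cst.exists_disj x y).choose_spec
  rw [sum_cycShuffles_eq hW hd, hx, hy]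

theorem CycStat.algLift_mul (hW : ∀ c, φ c.fund = W (cst.permClass c)) (x y : cst.Alg) :
    CycStat.algLift W (x * y) = CycStat.algLift W x * CycStat.algLift W y := by
  change CycStat.algLift W (∑ a ∈ Finsupp.support x, ∑ b ∈ Finsupp.support y,
    (x.toFun a * y.toFun b) • cst.mulBasis a b) =
      (∑ a ∈ Finsupp.support x, x.toFun a • W a) * ∑ b ∈ Finsupp.support y, y.toFun b • W b
  rw [map_sum, Finset.sum_mul_sum]
  refine Finset.sum_congr rfl fun a _ => ?_
  rw [map_sum]
  refine Finset.sum_congr rfl fun b _ => ?_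
  rw [map_smul, CycStat.algLift_mulBasis hW, smul_mul_smul_comm]

theorem CycStat.algLift_one (hW : ∀ c, φ c.fund = W (cst.permClass c)) :
    CycStat.algLift W (1 : cst.Alg) = 1 := by
  change CycStat.algLift W (cst.of LinPerm.empty.cyc) = 1
  rw [CycStat.algLift_of, ← hW, CycPerm.fund_empty, map_one]

theorem CycStat.range_algLift :
    LinearMap.range (CycStat.algLift W) = Submodule.span ℚ (Set.range W) :=
  Finsupp.range_linearCombination ℚ

/-- The range of the linear extension of `W` contains 1 and is closed under products; independence
makes the extension injective. -/
theorem exists_linearEquiv_subalgebra (hW : ∀ c, φ c.fund = W (cst.permClass c))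
    (hli : LinearIndependent ℚ W) :
    ∃ (B : Subalgebra ℚ A) (e : cst.Alg ≃ₗ[ℚ] B),
      Subalgebra.toSubmodule B = Submodule.span ℚ (Set.range W) ∧
      (∀ c : CycPerm, (e (cst.of c) : A) = W (cst.permClass c)) ∧
      (∀ x y : cst.Alg, e (x * y) = e x * e y) ∧ e 1 = 1 := by
  let B : Subalgebra ℚ A := (LinearMap.range (CycStat.algLift W)).toSubalgebra
    ⟨1, CycStat.algLift_one hW⟩ (by
      rintro _ _ ⟨x, rfl⟩ ⟨y, rfl⟩
      exact ⟨x * y, CycStat.algLift_mul hW x y⟩)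
  have hB : Subalgebra.toSubmodule B = LinearMap.range (CycStat.algLift W) :=
    Submodule.toSubalgebra_toSubmodule _ _ _
  have hinj : Function.Injective (CycStat.algLift W) :=
    linearIndependent_iff_injective_finsuppLinearCombination.1 hli
  let e : cst.Alg ≃ₗ[ℚ] B := (LinearEquiv.ofInjective _ hinj).trans
    ((LinearEquiv.ofEq _ _ hB.symm).trans (Subalgebra.toSubmoduleEquiv B))
  have he : ∀ x, (e x : A) = CycStat.algLift W x := fun _ => rfl
  refine ⟨B, e, hB.trans CycStat.range_algLift, fun c => (he _).trans (CycStat.algLift_of c),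
    fun x y => Subtype.ext ?_, Subtype.ext ?_⟩
  · rw [MulMemClass.coe_mul, he, he, he, CycStat.algLift_mul hW]
  · rw [he, CycStat.algLift_one hW, OneMemClass.coe_one]

end Realization

end CyclicShuffle
theorem theorem3p7 {β γ A : Type*} [Ring A] [Algebra ℚ A]
    (cst : CycStat β) (hcst : cst.IsCyclicDescentStat)
    (st : LinStat γ) (hst : st.IsDescentStat) (hsc : st.ShuffleCompatible)
    (u : Module.Basis st.CompClass ℚ A) (φ : QSym →ₐ[ℚ] A)
    (hφ : ∀ L : AnyComp, φ (fundComp L) = u (st.compClass L)) :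
    -- `cQSym⁻` is a subalgebra, and the formula for `φ_cst` defines an algebra homomorphism on it
    (∃ C : Subalgebra ℚ QSym, Subalgebra.toSubmodule C = cQSymMinus ∧
      ∃! φc : C →ₐ[ℚ] A, ∀ (n : ℕ) (S : Finset ℕ), NonEscher n S →
        ∃ hF : cycFund n S ∈ C, φc ⟨cycFund n S, hF⟩ = cycImage φ n S) ∧
    -- if its values depend only on classes, being given by a linearly independent family `v`:
    (∀ v : cst.CompClass → A,
      (∀ (n : ℕ) (S : Finset ℕ) (hS : NonEscher n S),
        cycImage φ n S = v (cst.compClass (neCComp n S hS))) →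
      LinearIndependent ℚ v →
      cst.CyclicShuffleCompatible ∧
      ∃ (B : Subalgebra ℚ A) (e : cst.Alg ≃ₗ[ℚ] B),
        Subalgebra.toSubmodule B = Submodule.span ℚ (Set.range v) ∧
        (∀ π : LinPerm, (e (cst.of π.cyc) : A) =
          v (cst.compClass (neCComp π.length π.cDes π.nonEscher))) ∧
        (∀ x y : cst.Alg, e (x * y) = e x * e y) ∧ e 1 = 1) := by
  refine ⟨⟨cQSymSubalgebra, Submodule.toSubalgebra_toSubmodule _ _ _,
    existsUnique_algHom_cQSym φ⟩, fun v hv hli => ?_⟩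
  have hbij := CycStat.classMap_bijective hcst
  -- Pulling `v` back along the bijection of classes gives a family on classes of permutations:
  -- injectivity preserves independence, and surjectivity preserves the span.
  have hW : ∀ c, φ c.fund = (v ∘ cst.classMap hcst) (cst.permClass c) := by
    intro c
    obtain ⟨π, rfl⟩ := c.exists_rep
    rw [← LinPerm.cycFund_eq, map_cycFund, hv _ _ π.nonEscher, Function.comp_apply,
      CycStat.classMap_permClass]
  have hliW := hli.comp _ hbij.1
  obtain ⟨B, e, hB, he, hmul, hone⟩ := exists_linearEquiv_subalgebra hW hliW
  refine ⟨cyclicShuffleCompatible_of_linearIndependent hW hliW, B, e, ?_, fun π => ?_, hmul, hone⟩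
  · rw [hB, hbij.2.range_comp]
  · rw [he, Function.comp_apply, CycStat.classMap_permClass]
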